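/- **Setting.** Let $n\ge 0$ and consider binary search trees (BSTs) whose set of keys is $[n]=\{1,\dots,n\}$. Let $d_T(i)$ denote the depth of key $i$ in $T$ (number of edges from the root to $i$), and let $S=(s_1,\dots,s_m)\in[n]^m$ be an access sequence. Logarithms are to base 2, and $n\log n$ is read as $0$ for $n=0$. Fix an integer $\kappa\ge 0$, a fixed charge for every access ($\kappa=0$: edges / unit operations only are counted; $\kappa=1$: nodes are counted). * *Move-to-root.* An access to $x$ in the current tree searches for $x$ and then rotates $x$ with its parent until it is the root; it costs $\kappa$ plus the depth of $x$ before the access. $MTR_T(S)$ is the total cost of accessing $s_1,\dots,s_m$ starting from the tree $T$. * *Optimum.* In the dynamic BST model, each access starts with a pointer at the root; the unit-cost operations are moving the pointer to a child or to the parent, and rotating the node at the pointer with its parent; the pointer must be at the accessed key at some moment. An access costs $\kappa$ plus the number of its operations. $OPT(S)$ is the minimum total cost of serving $S$, over all initial trees on $[n]$ and all ways of serving $S$. * *Key-independent costs.* For a permutation $\pi$ of $[n]$ let $\pi(S)=(\pi(s_1),\dots,\pi(s_m))$. With $\pi$ uniformly random, $\text{KI-MTR}_T(S)=E_\pi[MTR_T(\pi(S))]$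 ($T$ is fixed) and $\text{KI-OPT}(S)=E_\pi[OPT(\pi(S))]$. * *Working set bound.* Let $\rho_S(j)=\max\{k<j: s_k=s_j\}$ (and $0$ if there is no such $k$), $w_S(j)=\{s_i:\rho_S(j)<i\le j\}$ and $WS(S)=\sum_{j=1}^m\log|w_S(j)|$. **Theorem.** 1. There is an absolute constant $C$ such that for all $\kappa$ and $n$, every BST $T$ on $[n]$ and every access sequence $S$ of length $m$, $$\text{KI-MTR}_T(S)\le C\Big(\kappa m+WS(S)+\sum_{i=1}^n d_T(i)\Big).$$ 2. For every $a>0$ there is a constant $C$, depending only on $a$, such that for all $\kappa$ and $n$, every BST $T$ on $[n]$ with $d_T(i)\le a\log n$ for all $i$, and every access sequence $S$ of length $m$, the following holds, where $X=\Theta(Y)$ means $X\le CY$ and $Y\le CX$. (a) For every $S$: $\text{KI-OPT}(S)\le C\cdot\text{KI-MTR}_T(S)$, $\ \text{KI-MTR}_T(S)\le C(\text{KI-OPT}(S)+n\log n)$, $\ \text{KI-MTR}_T(S)\le C(\kappa m+WS(S)+n\log n)$, and $$\text{KI-OPT}(S)+n\log n=\Theta(\kappa m+WS(S)+n\log n).$$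 (b) If $\kappa m\ge n\log n$, or if every key of $[n]$ occurs in $S$, then $$\text{KI-MTR}_T(S)=\Theta(\text{KI-OPT}(S)+n\log n)=\Theta(\kappa m+WS(S)+n\log n),$$ and also $\text{KI-MTR}_T(S)=\Theta(\text{KI-OPT}(S))$ and $\text{KI-MTR}_T(S)=\Theta(\kappa m+WS(S))$. In particular Move-to-root is optimal in the key-independent setting. -/

import Mathlib

namespace KIBST

/-! ### Binary search trees on the keys `Fin n` -/

/-- The keys of a tree in symmetric order. -/
def inorder {α : Type} : BinaryTree α → List α
  | .nil => []
  | .node k l r => inorder l ++ k :: inorder r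

/-- `T` is a binary search tree whose set of keys is all of `Fin n`
(every key occurs exactly once). -/
def IsBSTOn (n : ℕ) (T : BinaryTree (Fin n)) : Prop :=
  inorder T = List.finRange n

/-- The depth of the key `x` in a binary search tree: the number of edges on the search path
from the root to `x`. (Only used for keys that occur in the tree.) -/
def depth {n : ℕ} (x : Fin n) : BinaryTree (Fin n) → ℕ
  | .nil => 0
  | .node k l r => if x = k then 0 else if x < k then depth x l + 1 else depth x r + 1

/-! ### Move-to-root -/

/-- Rotate the edge between the root and its left child. -/
def rotateRight {α : Type} : BinaryTree α → BinaryTree α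
  | .node p (.node x a b) r => .node x a (.node p b r)
  | t => t

/-- Rotate the edge between the root and its right child. -/
def rotateLeft {α : Type} : BinaryTree α → BinaryTree α
  | .node p l (.node x a b) => .node x (.node p l a) b
  | t => t

/-- The tree after `x` has been searched for and then rotated with its parent until it is the
root. -/
def moveToRoot {n : ℕ} (x : Fin n) : BinaryTree (Fin n) → BinaryTree (Fin n)
  | .nil => .nil
  | .node k l r =>
      if x = k then .node k l r
      else if x < k then rotateRight (.node k (moveToRoot x l) r)
      else rotateLeft (.node k l (moveToRoot x r))

/-- Total cost of Move-to-root on the access sequence `S` with initial tree `T`. Every access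
is charged `κ` plus the depth of the accessed key in the current tree, so `κ = 0` counts the
edges of the search paths and `κ = 1` counts their nodes. -/
def mtrCost {n : ℕ} (κ : ℕ) : BinaryTree (Fin n) → List (Fin n) → ℕ
  | _, [] => 0
  | T, x :: S => (κ + depth x T) + mtrCost κ (moveToRoot x T) S

/-! ### The dynamic BST model and the offline optimum -/

/-- One step on the way from a node up to its parent: which child we come from, the parent's
key, and the parent's other subtree. -/
inductive Frame (α : Type) : Type
  /-- we come from the left child; parent key `p`, right subtree `r` -/
  | fromLeft (p : α) (r : BinaryTree α) : Frame α
  /-- we come from the right child; parent key `p`, left subtree `l` -/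
  | fromRight (p : α) (l : BinaryTree α) : Frame α

/-- A tree with a pointer to one of its positions: `focus` is the subtree at the pointer and
`path` lists the frames from the pointer up to the root. -/
structure Pointed (α : Type) : Type where
  /-- the frames from the pointer up to the root -/
  path : List (Frame α)
  /-- the subtree at the pointer -/
  focus : BinaryTree α

/-- Plug a subtree into the context given by a path. -/
def plug {α : Type} : List (Frame α) → BinaryTree α → BinaryTree α
  | [], t => t
  | .fromLeft p r :: c, t => plug c (.node p t r)
  | .fromRight p l :: c, t => plug c (.node p l t)

/-- The whole tree of a pointed tree. -/
def Pointed.tree {α : Type} (P : Pointed α) : BinaryTree α := plug P.path P.focus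

/-- The pointed tree with its pointer at the root. -/
def atRoot {α : Type} (T : BinaryTree α) : Pointed α := ⟨[], T⟩

/-- The pointer is at a node with key `x`. -/
def Pointed.IsAt {α : Type} (P : Pointed α) (x : α) : Prop :=
  ∃ l r, P.focus = .node x l r

/-- The unit-cost operations: move the pointer to a child or to the parent, or rotate the edge
between the node at the pointer and its parent (the pointer stays at its node). -/
inductive Step {α : Type} : Pointed α → Pointed α → Prop
  | moveLeft (c : List (Frame α)) (p x : α) (a b r : BinaryTree α) :
      Step ⟨c, .node p (.node x a b) r⟩ ⟨.fromLeft p r :: c, .node x a b⟩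
  | moveRight (c : List (Frame α)) (p x : α) (a b l : BinaryTree α) :
      Step ⟨c, .node p l (.node x a b)⟩ ⟨.fromRight p l :: c, .node x a b⟩
  | moveUpLeft (c : List (Frame α)) (p : α) (t r : BinaryTree α) :
      Step ⟨.fromLeft p r :: c, t⟩ ⟨c, .node p t r⟩
  | moveUpRight (c : List (Frame α)) (p : α) (t l : BinaryTree α) :
      Step ⟨.fromRight p l :: c, t⟩ ⟨c, .node p l t⟩
  | rotateUpLeft (c : List (Frame α)) (p x : α) (a b r : BinaryTree α) :
      Step ⟨.fromLeft p r :: c, .node x a b⟩ ⟨c, .node x a (.node p b r)⟩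
  | rotateUpRight (c : List (Frame α)) (p x : α) (a b l : BinaryTree α) :
      Step ⟨.fromRight p l :: c, .node x a b⟩ ⟨c, .node x (.node p l a) b⟩

/-- `Q` is obtained from `P` by exactly `k` unit-cost operations. -/
inductive Steps {α : Type} : ℕ → Pointed α → Pointed α → Prop
  | refl (P : Pointed α) : Steps 0 P P
  | tail {k : ℕ} {P Q R : Pointed α} : Steps k P Q → Step Q R → Steps (k + 1) P R

/-- In the tree `T`, the key `x` can be accessed with `k` unit-cost operations in such a way
that the resulting tree is `T'`: the pointer starts at the root and is at `x` at some moment. -/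
def Access {α : Type} (T : BinaryTree α) (x : α) (k : ℕ) (T' : BinaryTree α) : Prop :=
  ∃ (k₁ k₂ : ℕ) (P Q : Pointed α), Steps k₁ (atRoot T) P ∧ P.IsAt x ∧ Steps k₂ P Q ∧
    Q.tree = T' ∧ k = k₁ + k₂

/-- Starting from the tree `T`, the access sequence `S` can be served at total cost `c`, where
every access is charged `κ` plus the number of its unit-cost operations. -/
inductive Serves {α : Type} (κ : ℕ) : BinaryTree α → List α → ℕ → Prop
  | nil (T : BinaryTree α) : Serves κ T [] 0
  | cons {T T' : BinaryTree α} {x : α} {S : List α} {k c : ℕ} :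
      Access T x k T' → Serves κ T' S c → Serves κ T (x :: S) ((κ + k) + c)

/-- The offline optimum: the least cost of serving `S`, over all initial binary search trees on
`Fin n` and all ways of serving `S`. -/
noncomputable def optCost {n : ℕ} (κ : ℕ) (S : List (Fin n)) : ℕ :=
  sInf {c | ∃ T : BinaryTree (Fin n), IsBSTOn n T ∧ Serves κ T S c}

/-! ### Key-independent costs -/

/-- The expectation of `f` at the relabelled sequence `π(S)`, for a uniformly random
permutation `π` of the keys. -/
noncomputable def relabelledMean {n : ℕ} (f : List (Fin n) → ℕ) (S : List (Fin n)) : ℝ :=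
  (∑ π : Equiv.Perm (Fin n), (f (S.map π) : ℝ)) / (n.factorial : ℝ)

/-- The key-independent Move-to-root cost with initial tree `T`. -/
noncomputable def kiMTR {n : ℕ} (κ : ℕ) (T : BinaryTree (Fin n)) (S : List (Fin n)) : ℝ :=
  relabelledMean (mtrCost κ T) S

/-- The key-independent optimum. -/
noncomputable def kiOPT {n : ℕ} (κ : ℕ) (S : List (Fin n)) : ℝ :=
  relabelledMean (optCost κ) S

/-! ### The working set bound -/

/-- The working set at time `j`: the keys accessed up to time `j` and after the last earlier
access to the key of time `j` (from the beginning on, if there is none). -/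
def workingSet {n : ℕ} (S : List (Fin n)) (j : Fin S.length) : Finset (Fin n) :=
  (Finset.univ.filter fun i : Fin S.length =>
    i ≤ j ∧ ∀ k : Fin S.length, k < j → S.get k = S.get j → k < i).image S.get

/-- The working set bound. -/
noncomputable def WS {n : ℕ} (S : List (Fin n)) : ℝ :=
  ∑ j : Fin S.length, Real.logb 2 ((workingSet S j).card : ℝ)

/-- `x` and `y` agree up to the constant factor `C`. -/
def AgreeUpTo (C x y : ℝ) : Prop := x ≤ C * y ∧ y ≤ C * x

end KIBST

/-! The cost of Move-to-root and the optimum are compared through the working set bound: under a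
random relabelling the first is at most, and the second at least, a constant multiple of it, apart
from the charge `κ` and the initial tree.

Upper bound. After some accesses, `y` can be a proper ancestor of `x` only if no key between `x` and
`y` was accessed after `y`, or if `x` has not been accessed yet and `y` was its ancestor initially
(`mem_ancestors_mtrTree`). Under a random relabelling, the key of zero-based rank `i` among those
accessed since `x` must be nearest to `x` on its side among `i + 1` keys, which has probability at
most `2 / (i + 1)`. The harmonic sum is of the order of the logarithm of the working set size
(`sum_exposed_le`), and the initial depths are paid once per key (`histSum_first_le`).

Lower bound. This is an interleave bound for a fixed dyadic hierarchy of blocks, each cut into two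
halves. A unit operation affects at most one block (`Step.exists_finset`), so a potential argument
bounds the total number of alternations between halves by twice the cost
(`Serves.interleave_le_two_mul`). If the working set has size `w`, then at each of the `⌊log w⌋`
coarsest levels a random relabelling makes the access alternate with probability at least `1/16`.
This follows by inclusion and exclusion over a prefix of the recent keys, long enough to hit the
opposite half and short enough to rarely hit the block twice (`factorial_le_mul_sum_alternates`).

Move-to-root is itself a strategy of the dynamic model, at twice its cost. The term `n log n` is
absorbed by `κ m` when the sequence is long, and by the working set bound when every key occurs
(`mul_logb_le_two_mul_WS`). -/

namespace KIBST

/-! ### The interleave lower bound for the dynamic BST model -/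

/-- The keys of a tree in preorder. -/
def preorder {α : Type} : BinaryTree α → List α
  | .nil => []
  | .node k l r => k :: (preorder l ++ preorder r)

theorem mem_preorder {α : Type} {x : α} {t : BinaryTree α} : x ∈ preorder t ↔ x ∈ inorder t := by
  induction t with
  | nil => simp [preorder, inorder]
  | node k l r ihl ihr => simp [preorder, inorder, ihl, ihr]; tauto

/-- The key of a parent recorded in a frame. -/
def Frame.key {α : Type} : Frame α → α
  | .fromLeft p _ => p
  | .fromRight p _ => p

/-- The key at the root of a tree, as a list with at most one element. -/
def rootKeys {α : Type} : BinaryTree α → List α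
  | .nil => []
  | .node k _ _ => [k]

/-- The keys on the path from the pointer to the root. -/
def Pointed.pathKeys {α : Type} (P : Pointed α) : List α :=
  rootKeys P.focus ++ P.path.map Frame.key

theorem exists_inorder_plug {α : Type} (c : List (Frame α)) :
    ∃ u v : List α, ∀ t, inorder (plug c t) = u ++ inorder t ++ v := by
  induction c with
  | nil => exact ⟨[], [], by simp [plug]⟩
  | cons f c ih =>
    obtain ⟨u, v, h⟩ := ih
    cases f with
    | fromLeft p r => exact ⟨u, p :: inorder r ++ v, fun t => by simp [plug, h, inorder]⟩
    | fromRight p l => exact ⟨u ++ inorder l ++ [p], v, fun t => by simp [plug, h, inorder]⟩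

theorem exists_preorder_plug {α : Type} (c : List (Frame α)) :
    ∃ u v : List α, (∀ t, preorder (plug c t) = u ++ preorder t ++ v) ∧
      ∀ a ∈ c.map Frame.key, a ∈ u := by
  induction c with
  | nil => exact ⟨[], [], by simp [plug]⟩
  | cons f c ih =>
    obtain ⟨u, v, h, hk⟩ := ih
    cases f with
    | fromLeft p r =>
      refine ⟨u ++ [p], preorder r ++ v, fun t => by simp [plug, h, preorder], ?_⟩
      intro a ha
      simp only [List.map_cons, List.mem_cons, Frame.key] at ha
      rcases ha with rfl | ha
      · simp
      · simp [hk a ha]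
    | fromRight p l =>
      refine ⟨u ++ p :: preorder l, v, fun t => by simp [plug, h, preorder], ?_⟩
      intro a ha
      simp only [List.map_cons, List.mem_cons, Frame.key] at ha
      rcases ha with rfl | ha
      · simp
      · simp [hk a ha]

theorem Step.inorder_eq {α : Type} {P Q : Pointed α} (h : Step P Q) :
    inorder Q.tree = inorder P.tree := by
  cases h with
  | moveLeft | moveRight | moveUpLeft | moveUpRight => rfl
  | rotateUpLeft c p x a b r =>
    obtain ⟨u, v, h⟩ := exists_inorder_plug c
    simp [Pointed.tree, plug, h, inorder]
  | rotateUpRight c p x a b l =>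
    obtain ⟨u, v, h⟩ := exists_inorder_plug c
    simp [Pointed.tree, plug, h, inorder]

theorem Steps.inorder_eq {α : Type} {k : ℕ} {P Q : Pointed α} (h : Steps k P Q) :
    inorder Q.tree = inorder P.tree := by
  induction h with
  | refl => rfl
  | tail _ hs ih => rw [hs.inorder_eq, ih]

/-- The dyadic block of size `2 ^ (y.1 + 1)` with index `y.2`. -/
def inBlock (y : ℕ × ℕ) {n : ℕ} (i : Fin n) : Bool := i.val / 2 ^ (y.1 + 1) = y.2

/-- The index of the dyadic interval of size `2 ^ k` that contains `i`. -/
def half (k : ℕ) {n : ℕ} (i : Fin n) : ℕ := i.val / 2 ^ k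

theorem inBlock_iff {n : ℕ} {y : ℕ × ℕ} {i : Fin n} :
    inBlock y i = true ↔ half (y.1 + 1) i = y.2 := by simp [inBlock, half]

theorem half_eq_of_le {n : ℕ} {j k : ℕ} (h : j ≤ k) {a b : Fin n} (hab : half j a = half j b) :
    half k a = half k b := by
  obtain ⟨d, rfl⟩ := Nat.exists_eq_add_of_le h
  unfold half at *
  rw [pow_add, ← Nat.div_div_eq_div_mul, ← Nat.div_div_eq_div_mul, hab]

theorem inBlock_convex {n : ℕ} {y : ℕ × ℕ} {a b c : Fin n} (hab : a ≤ b) (hbc : b ≤ c)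
    (ha : inBlock y a = true) (hc : inBlock y c = true) : inBlock y b = true := by
  rw [inBlock_iff] at *
  have h1 : half (y.1 + 1) a ≤ half (y.1 + 1) b := Nat.div_le_div_right hab
  have h2 : half (y.1 + 1) b ≤ half (y.1 + 1) c := Nat.div_le_div_right hbc
  omega

/-- The half of the block `y` that contains the topmost key of this block. -/
def topHalf {n : ℕ} (y : ℕ × ℕ) (t : BinaryTree (Fin n)) : Option ℕ :=
  ((preorder t).find? (inBlock y)).map (half y.1)

/-- The path of the pointer meets both halves of the block `y`. -/
def MeetsBoth {n : ℕ} (y : ℕ × ℕ) (P : Pointed (Fin n)) : Prop :=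
  ∃ a ∈ P.pathKeys, ∃ b ∈ P.pathKeys, inBlock y a = true ∧ inBlock y b = true ∧
    half y.1 a ≠ half y.1 b

/-- Among the ancestors `A` of `x` there are keys of the half of the block `y` opposite to `x`, and
only keys of that half. -/
def IsTransition {n : ℕ} (y : ℕ × ℕ) (x : Fin n) (A : List (Fin n)) : Prop :=
  inBlock y x = true ∧ (∃ a ∈ A, inBlock y a = true) ∧
    ∀ a ∈ A, inBlock y a = true → half y.1 a ≠ half y.1 x

/-- Were `y` of lower level than `z`, the ancestor in the block `y` would lie with `x` in a single
half of `z`, against the transition at `z`. By symmetry a key has a transition at one block at most.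
-/
theorem IsTransition.le {n : ℕ} {y z : ℕ × ℕ} {x : Fin n} {A : List (Fin n)}
    (hy : IsTransition y x A) (hz : IsTransition z x A) : z.1 ≤ y.1 := by
  by_contra! hlt
  obtain ⟨hx, ⟨a, ha, hay⟩, -⟩ := hy
  obtain ⟨hxz, -, hz⟩ := hz
  rw [inBlock_iff] at hx hay hxz
  have h1 : half z.1 a = half z.1 x := half_eq_of_le hlt (hay.trans hx.symm)
  refine hz a ha ?_ h1
  rw [inBlock_iff, ← hxz]
  exact half_eq_of_le (Nat.le_succ _) h1

theorem IsTransition.unique {n : ℕ} {y z : ℕ × ℕ} {x : Fin n} {A : List (Fin n)}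
    (hy : IsTransition y x A) (hz : IsTransition z x A) : y = z := by
  have h1 : y.1 = z.1 := le_antisymm (hz.le hy) (hy.le hz)
  have h2 := inBlock_iff.1 hy.1
  have h3 := inBlock_iff.1 hz.1
  refine Prod.ext h1 ?_
  rw [← h2, ← h3, h1]

theorem meetsBoth_of_pathKeys_subset {n : ℕ} {y : ℕ × ℕ} {P Q : Pointed (Fin n)}
    (h : Q.pathKeys ⊆ P.pathKeys) (hQ : MeetsBoth y Q) : MeetsBoth y P := by
  obtain ⟨a, ha, b, hb, h'⟩ := hQ
  exact ⟨a, h ha, b, h hb, h'⟩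

/-- Only `x` joins the path, so a newly met half is the half of `x`, and the old path met only the
other one. -/
theorem isTransition_of_meetsBoth {n : ℕ} {y : ℕ × ℕ} {P Q : Pointed (Fin n)} {x : Fin n}
    (h : Q.pathKeys = x :: P.pathKeys) (hQ : MeetsBoth y Q) (hP : ¬ MeetsBoth y P) :
    IsTransition y x P.pathKeys := by
  obtain ⟨a, ha, b, hb, hay, hby, hab⟩ := hQ
  rw [h, List.mem_cons] at ha hb
  have key : ∀ a ∈ P.pathKeys, inBlock y a = true → inBlock y x = true →
      half y.1 a ≠ half y.1 x → IsTransition y x P.pathKeys := by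
    intro a ha hay hxy hax
    refine ⟨hxy, ⟨a, ha, hay⟩, fun b hb hby hbx => hP ⟨a, ha, b, hb, hay, hby, ?_⟩⟩
    rwa [hbx]
  rcases ha with rfl | ha <;> rcases hb with rfl | hb
  · exact absurd rfl hab
  · exact key b hb hby hay hab.symm
  · exact key a ha hay hby hab
  · exact absurd ⟨a, ha, b, hb, hay, hby, hab⟩ hP

/-- The strict order of the keys of a search tree in symmetric order. -/
def Ordered {n : ℕ} (t : BinaryTree (Fin n)) : Prop := (inorder t).Pairwise (· < ·)

theorem IsBSTOn.ordered {n : ℕ} {t : BinaryTree (Fin n)} (h : IsBSTOn n t) : Ordered t := by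
  unfold Ordered
  rw [h]
  exact List.pairwise_lt_finRange n

theorem IsBSTOn.mem {n : ℕ} {t : BinaryTree (Fin n)} (h : IsBSTOn n t) (x : Fin n) :
    x ∈ inorder t := by
  rw [h]
  exact List.mem_finRange x

theorem ordered_node {n : ℕ} {k : Fin n} {l r : BinaryTree (Fin n)} :
    Ordered (.node k l r) ↔ Ordered l ∧ Ordered r ∧ (∀ a ∈ inorder l, a < k) ∧
      (∀ b ∈ inorder r, k < b) := by
  simp only [Ordered, inorder, List.pairwise_append, List.pairwise_cons, List.mem_cons]
  constructor
  · rintro ⟨h1, ⟨h2, h3⟩, h4⟩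
    exact ⟨h1, h3, fun a ha => h4 a ha k (Or.inl rfl), h2⟩
  · rintro ⟨h1, h2, h3, h4⟩
    refine ⟨h1, ⟨h4, h2⟩, fun a ha b hb => ?_⟩
    rcases hb with rfl | hb
    · exact h3 a ha
    · exact (h3 a ha).trans (h4 b hb)

theorem Ordered.of_plug {n : ℕ} {c : List (Frame (Fin n))} {t : BinaryTree (Fin n)}
    (h : Ordered (plug c t)) : Ordered t := by
  obtain ⟨u, v, hp⟩ := exists_inorder_plug c
  unfold Ordered at *
  rw [hp] at h
  exact (List.pairwise_append.1 (List.pairwise_append.1 h).1).2.1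

/-- The path above precedes the rotated subtree in preorder. If it contains a key of the block, the
first such key is unaffected. Otherwise the change must be from `p` to `x` in different halves, and
`p` is the only ancestor in the block. -/
theorem isTransition_of_topHalf_ne {n : ℕ} {y : ℕ × ℕ} {c : List (Frame (Fin n))} {p x : Fin n}
    {t t' : BinaryTree (Fin n)}
    (h1 : ¬ (inBlock y p = true ∧ inBlock y x = true) →
      (preorder t).find? (inBlock y) = (preorder t').find? (inBlock y))
    (h2 : inBlock y p = true → inBlock y x = true →
      (preorder t).find? (inBlock y) = some p ∧ (preorder t').find? (inBlock y) = some x)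
    (hne : topHalf y (plug c t') ≠ topHalf y (plug c t)) :
    IsTransition y x (p :: c.map Frame.key) := by
  obtain ⟨u, v, h, hk⟩ := exists_preorder_plug c
  simp only [topHalf, h, List.find?_append] at hne
  by_cases hpx : inBlock y p = true ∧ inBlock y x = true
  swap
  · rw [h1 hpx] at hne
    exact absurd rfl hne
  obtain ⟨h3, h4⟩ := h2 hpx.1 hpx.2
  rw [h3, h4] at hne
  cases hu : u.find? (inBlock y) with
  | some g => simp [hu] at hne
  | none =>
    simp [hu] at hne
    rw [List.find?_eq_none] at hu
    refine ⟨hpx.2, ⟨p, by simp, hpx.1⟩, fun a ha hay => ?_⟩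
    rcases List.mem_cons.1 ha with rfl | ha
    · exact fun h => hne h.symm
    · exact absurd hay (hu a (hk a ha))

theorem find?_preorder_eq_none {n : ℕ} {y : ℕ × ℕ} {t : BinaryTree (Fin n)}
    (h : ∀ a ∈ inorder t, ¬ inBlock y a = true) : (preorder t).find? (inBlock y) = none := by
  rw [List.find?_eq_none]
  exact fun a ha => h a (mem_preorder.1 ha)

/-- One key `x` and one list of ancestors serve all blocks simultaneously, so that uniqueness of
transitions applies. Moving down can only make a path meet both halves, rotating can only change the
topmost key, and moving up does neither. -/
theorem Step.exists_isTransition {n : ℕ} {P Q : Pointed (Fin n)} (h : Step P Q)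
    (hP : Ordered P.tree) :
    ∃ (x : Fin n) (A : List (Fin n)), ∀ y, (topHalf y Q.tree ≠ topHalf y P.tree ∨ (MeetsBoth y Q ∧ ¬ MeetsBoth y P)) →
      IsTransition y x A := by
  cases h with
  | moveLeft c p x a b r =>
    refine ⟨x, _, fun y hy => hy.elim (fun h => absurd rfl h) fun h =>
      isTransition_of_meetsBoth ?_ h.1 h.2⟩
    simp [Pointed.pathKeys, rootKeys, Frame.key]
  | moveRight c p x a b l =>
    refine ⟨x, _, fun y hy => hy.elim (fun h => absurd rfl h) fun h =>
      isTransition_of_meetsBoth ?_ h.1 h.2⟩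
    simp [Pointed.pathKeys, rootKeys, Frame.key]
  | moveUpLeft c p t r =>
    refine ⟨p, [], fun y hy => hy.elim (fun h => absurd rfl h) fun h =>
      absurd (meetsBoth_of_pathKeys_subset ?_ h.1) h.2⟩
    simp [Pointed.pathKeys, rootKeys, Frame.key]
  | moveUpRight c p t l =>
    refine ⟨p, [], fun y hy => hy.elim (fun h => absurd rfl h) fun h =>
      absurd (meetsBoth_of_pathKeys_subset ?_ h.1) h.2⟩
    simp [Pointed.pathKeys, rootKeys, Frame.key]
  | rotateUpLeft c p x a b r =>
    have ho : Ordered (.node p (.node x a b) r) := Ordered.of_plug (c := c) hP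
    simp only [ordered_node, inorder, List.mem_append, List.mem_cons] at ho
    obtain ⟨⟨-, -, hax, hxb⟩, -, hp, hr⟩ := ho
    have hxp : x < p := hp x (by simp)
    refine ⟨x, p :: c.map Frame.key, fun y hy => hy.elim (fun h => ?_) fun h =>
      absurd (meetsBoth_of_pathKeys_subset ?_ h.1) h.2⟩
    · refine isTransition_of_topHalf_ne (t := .node p (.node x a b) r) ?_ ?_ h
      · intro hpx
        by_cases hx : inBlock y x = true
        · have hp' : ¬ inBlock y p = true := fun h => hpx ⟨h, hx⟩
          simp [preorder, hx, hp']
        · by_cases hp' : inBlock y p = true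
          -- The rotation puts `a` before `p` in preorder. This is harmless, since a key of the
          -- block in `a` would force the key `x` between it and `p` into the block.
          · have : (preorder a).find? (inBlock y) = none :=
              find?_preorder_eq_none fun i hi hiy =>
                hx (inBlock_convex (hax i hi).le hxp.le hiy hp')
            simp [preorder, hx, hp', List.find?_append, this]
          · simp [preorder, hx, hp', List.find?_append]
      · intro hp' hx
        simp [preorder, hp', hx]
    · intro i
      simp [Pointed.pathKeys, rootKeys, Frame.key]
      tauto
  | rotateUpRight c p x a b l =>
    have ho : Ordered (.node p l (.node x a b)) := Ordered.of_plug (c := c) hP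
    simp only [ordered_node, inorder, List.mem_append, List.mem_cons] at ho
    obtain ⟨-, ⟨-, -, hax, hxb⟩, hl, hp⟩ := ho
    have hxp : p < x := hp x (by simp)
    refine ⟨x, p :: c.map Frame.key, fun y hy => hy.elim (fun h => ?_) fun h =>
      absurd (meetsBoth_of_pathKeys_subset ?_ h.1) h.2⟩
    · refine isTransition_of_topHalf_ne (t := .node p l (.node x a b)) ?_ ?_ h
      · intro hpx
        by_cases hx : inBlock y x = true
        · have hp' : ¬ inBlock y p = true := fun h => hpx ⟨h, hx⟩
          have : (preorder l).find? (inBlock y) = none :=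
            find?_preorder_eq_none fun i hi hiy =>
              hp' (inBlock_convex (hl i hi).le hxp.le hiy hx)
          simp [preorder, hx, hp', List.find?_append, this]
        · by_cases hp' : inBlock y p = true
          · simp [preorder, hx, hp']
          · simp [preorder, hx, hp', List.find?_append]
      · intro hp' hx
        simp [preorder, hp', hx]
    · intro i
      simp [Pointed.pathKeys, rootKeys, Frame.key]
      tauto

theorem Step.exists_finset {n : ℕ} {P Q : Pointed (Fin n)} (h : Step P Q) (hP : Ordered P.tree) :
    ∃ E : Finset (ℕ × ℕ), E.card ≤ 1 ∧ ∀ y ∉ E, topHalf y Q.tree = topHalf y P.tree ∧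
      (MeetsBoth y Q → MeetsBoth y P) := by
  obtain ⟨x, A, hxA⟩ := h.exists_isTransition hP
  by_cases hy : ∃ y, IsTransition y x A
  · obtain ⟨y, hy⟩ := hy
    refine ⟨{y}, by simp, fun z hz => ?_⟩
    by_contra hcon
    refine hz (Finset.mem_singleton.2 (IsTransition.unique (hxA z ?_) hy))
    tauto
  · refine ⟨∅, by simp, fun z hz => ?_⟩
    by_contra hcon
    refine hy ⟨z, hxA z ?_⟩
    tauto

theorem Steps.exists_finset {n k : ℕ} {P Q : Pointed (Fin n)} (h : Steps k P Q)
    (hP : Ordered P.tree) :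
    ∃ E : Finset (ℕ × ℕ), E.card ≤ k ∧ ∀ y ∉ E, topHalf y Q.tree = topHalf y P.tree ∧
      (MeetsBoth y Q → MeetsBoth y P) := by
  induction h with
  | refl P => exact ⟨∅, by simp, fun y _ => ⟨rfl, id⟩⟩
  | @tail k P Q R hs hq ih =>
    obtain ⟨E, hE, h1⟩ := ih hP
    have hQ : Ordered Q.tree := by
      unfold Ordered at *
      rwa [hs.inorder_eq]
    obtain ⟨F, hF, h2⟩ := hq.exists_finset hQ
    refine ⟨E ∪ F, (Finset.card_union_le _ _).trans (by omega), fun y hy => ?_⟩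
    rw [Finset.mem_union, not_or] at hy
    exact ⟨(h2 y hy.2).1.trans (h1 y hy.1).1, fun h => (h1 y hy.1).2 ((h2 y hy.2).2 h)⟩

/-- A block is an interval, so its first key in preorder is an ancestor of all its other keys.
Following the search path to `x`, a skipped left subtree has no key of the block unless the parent
is in the block too. -/
theorem mem_path_of_find?_plug {n : ℕ} {y : ℕ × ℕ} {x g : Fin n} (hx : inBlock y x = true)
    (c : List (Frame (Fin n))) (t : BinaryTree (Fin n)) (ho : Ordered (plug c t))
    (hxt : x ∈ inorder t) (hg : (preorder (plug c t)).find? (inBlock y) = some g) :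
    g ∈ c.map Frame.key ∨ (preorder t).find? (inBlock y) = some g := by
  induction c generalizing t with
  | nil => exact Or.inr hg
  | cons f c ih =>
    have hsome : ∃ i, (preorder t).find? (inBlock y) = some i := by
      rw [← Option.isSome_iff_exists, List.find?_isSome]
      exact ⟨x, mem_preorder.2 hxt, hx⟩
    obtain ⟨i, hi⟩ := hsome
    cases f with
    | fromLeft p r =>
      rcases ih (.node p t r) ho (by simp [inorder, hxt]) hg with h | h
      · exact Or.inl (by simp [h])
      · by_cases hp : inBlock y p = true
        · simp [preorder, hp] at h
          exact Or.inl (by simp [Frame.key, h])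
        · simp [preorder, hp, List.find?_append, hi] at h
          exact Or.inr (by rw [hi, h])
    | fromRight p l =>
      have ho' : Ordered (.node p l t) := Ordered.of_plug (c := c) ho
      rw [ordered_node] at ho'
      rcases ih (.node p l t) ho (by simp [inorder, hxt]) hg with h | h
      · exact Or.inl (by simp [h])
      · by_cases hp : inBlock y p = true
        · simp [preorder, hp] at h
          exact Or.inl (by simp [Frame.key, h])
        · have : (preorder l).find? (inBlock y) = none :=
            find?_preorder_eq_none fun j hj hjy =>
              hp (inBlock_convex (ho'.2.2.1 j hj).le (ho'.2.2.2 x hxt).le hjy hx)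
          simp [preorder, hp, List.find?_append, hi, this] at h
          exact Or.inr (by rw [hi, h])

theorem Pointed.IsAt.topHalf_eq {n : ℕ} {y : ℕ × ℕ} {x : Fin n} {P : Pointed (Fin n)}
    (hP : P.IsAt x) (ho : Ordered P.tree) (hx : inBlock y x = true) (hv : ¬ MeetsBoth y P) :
    topHalf y P.tree = some (half y.1 x) := by
  obtain ⟨l, r, hlr⟩ := hP
  have hxt : x ∈ inorder P.focus := by simp [hlr, inorder]
  have hsome : ∃ g, (preorder P.tree).find? (inBlock y) = some g := by
    rw [← Option.isSome_iff_exists, List.find?_isSome]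
    refine ⟨x, ?_, hx⟩
    obtain ⟨u, v, h⟩ := exists_inorder_plug P.path
    simp [mem_preorder, Pointed.tree, h, hxt]
  obtain ⟨g, hg⟩ := hsome
  rw [topHalf, hg, Option.map_some, Option.some_inj]
  have hgy : inBlock y g = true := by simpa using List.find?_some hg
  by_contra hne
  refine hv ⟨g, ?_, x, by simp [Pointed.pathKeys, hlr, rootKeys], hgy, hx, hne⟩
  rcases mem_path_of_find?_plug hx P.path P.focus ho hxt hg with h | h
  · simp only [Pointed.pathKeys, List.mem_append]
    exact Or.inr h
  · simp [hlr, preorder, hx] at h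
    simp [Pointed.pathKeys, hlr, rootKeys, h]

theorem Access.inorder_eq {α : Type} {T T' : BinaryTree α} {x : α} {k : ℕ}
    (h : Access T x k T') : inorder T' = inorder T := by
  obtain ⟨k₁, k₂, P, Q, h1, -, h2, rfl, -⟩ := h
  rw [h2.inorder_eq, h1.inorder_eq]
  rfl

/-- The pointer starts with a single key on its path, hence meets both halves of no block. For an
unaffected block containing `x` this still holds on arrival at `x`, and the topmost key of the
block, being on the path, is in the half of `x`. -/
theorem Access.exists_finset {n k : ℕ} {T T' : BinaryTree (Fin n)} {x : Fin n}
    (h : Access T x k T') (hT : Ordered T) :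
    ∃ E : Finset (ℕ × ℕ), E.card ≤ k ∧ ∀ y ∉ E, topHalf y T' = topHalf y T ∧
      (inBlock y x = true → topHalf y T = some (half y.1 x)) := by
  obtain ⟨k₁, k₂, P, Q, h1, hx, h2, rfl, rfl⟩ := h
  have hP : Ordered P.tree := by
    unfold Ordered at *
    rw [h1.inorder_eq]
    exact hT
  obtain ⟨E, hE, hE'⟩ := h1.exists_finset hT
  obtain ⟨F, hF, hF'⟩ := h2.exists_finset hP
  refine ⟨E ∪ F, (Finset.card_union_le _ _).trans (by omega), fun y hy => ?_⟩
  rw [Finset.mem_union, not_or] at hy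
  obtain ⟨hE1, hE2⟩ := hE' y hy.1
  refine ⟨(hF' y hy.2).1.trans hE1, fun hxy => ?_⟩
  have hroot : ¬ MeetsBoth y (atRoot T) := by
    rintro ⟨a, ha, b, hb, -, -, hab⟩
    cases T with
    | nil => simp [Pointed.pathKeys, atRoot, rootKeys] at ha
    | node =>
      simp [Pointed.pathKeys, atRoot, rootKeys] at ha hb
      exact hab (by rw [ha, hb])
  have := hx.topHalf_eq hP hxy fun h => hroot (hE2 h)
  rw [← this, hE1]
  rfl

/-! ### Amortizing alternations against mismatches -/

/-- An access to `x` after the accesses `H` (latest first) alternates at level `k`: the latest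
access to the block of size `2 ^ (k + 1)` around `x` was to the half opposite to `x`. -/
def Alternates {n : ℕ} (k : ℕ) (x : Fin n) (H : List (Fin n)) : Prop :=
  ∃ b, H.find? (inBlock (k, half (k + 1) x)) = some b ∧ half k b ≠ half k x

/-- The latest access to the block `y` was not to the half with the topmost key of the block. -/
def Mismatch {n : ℕ} (y : ℕ × ℕ) (T : BinaryTree (Fin n)) (H : List (Fin n)) : Prop :=
  ∃ b g, H.find? (inBlock y) = some b ∧ topHalf y T = some g ∧ half y.1 b ≠ g

/-- The sum of `F x H` over all accesses, where `x` is the accessed key and `H` is the list of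
the accesses before it, latest first, on top of an initial history. -/
def histSum {α M : Type*} [AddMonoid M] (F : α → List α → M) : List α → List α → M
  | _, [] => 0
  | H, x :: S => F x H + histSum F (x :: H) S

open Classical in
/-- The number of levels below `K` at which an access alternates. -/
noncomputable def alternations {n : ℕ} (K : ℕ) (x : Fin n) (H : List (Fin n)) : ℕ :=
  ((Finset.range K).filter fun k => Alternates k x H).card

open Classical in
/-- The number of blocks with a mismatch. -/
noncomputable def mismatches {n : ℕ} (K : ℕ) (T : BinaryTree (Fin n)) (H : List (Fin n)) : ℕ :=
  ((Finset.range K ×ˢ Finset.range n).filter fun y => Mismatch y T H).card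

-- The number of mismatches is the potential. An affected block contributes at most one alternation
-- and one new mismatch, whence `2 * k`. At an unaffected block around `x`, an alternation uses up a
-- mismatch and none remains afterwards; at any other unaffected block nothing changes.
open Classical in
theorem Access.alternations_le {n k : ℕ} {T T' : BinaryTree (Fin n)} {x : Fin n}
    (h : Access T x k T') (hT : Ordered T) (K : ℕ) (H : List (Fin n)) :
    alternations K x H + mismatches K T' (x :: H) ≤ 2 * k + mismatches K T H := by
  obtain ⟨E, hE, hE'⟩ := h.exists_finset hT
  obtain ⟨Y, hY⟩ : ∃ Y, Y = Finset.range K ×ˢ Finset.range n := ⟨_, rfl⟩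
  have hq : ∀ k, half k x < n := fun k => (Nat.div_le_self _ _).trans_lt x.2
  have h1 : alternations K x H ≤
      (Y.filter fun y => inBlock y x = true ∧ Alternates y.1 x H).card := by
    refine Finset.card_le_card_of_injOn (fun k => (k, half (k + 1) x)) ?_ ?_
    · intro k hk
      simp only [Finset.coe_filter, Finset.mem_range, Set.mem_ofPred_eq] at hk
      simp [hY, hk.1, hq, hk.2, inBlock_iff]
    · intro a _ b _ hab
      exact (Prod.ext_iff.1 hab).1
  have h2 : (Y.filter fun y => y ∈ E).card ≤ k :=
    (Finset.card_le_card fun y hy => (Finset.mem_filter.1 hy).2).trans hE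
  have h3 : (Y.filter fun y => inBlock y x = true ∧ Alternates y.1 x H).card +
      mismatches K T' (x :: H) ≤ 2 * (Y.filter fun y => y ∈ E).card + mismatches K T H := by
    unfold mismatches
    rw [← hY]
    simp only [Finset.card_filter, Finset.mul_sum, ← Finset.sum_add_distrib]
    refine Finset.sum_le_sum fun y _ => ?_
    by_cases hy : y ∈ E
    · simp only [hy, if_true]
      split_ifs <;> omega
    obtain ⟨ht, hx⟩ := hE' y hy
    by_cases hxy : inBlock y x = true
    · have hm : ¬ Mismatch y T' (x :: H) := by
        rintro ⟨b, g, hb, hg, hbg⟩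
        rw [ht, hx hxy, Option.some_inj] at hg
        simp [hxy] at hb
        exact hbg (by rw [← hb, hg])
      have ha : Alternates y.1 x H → Mismatch y T H := by
        rintro ⟨b, hb, hbx⟩
        have : (y.1, half (y.1 + 1) x) = y := Prod.ext rfl (inBlock_iff.1 hxy)
        rw [this] at hb
        exact ⟨b, _, hb, hx hxy, hbx⟩
      simp only [hm, if_false, hy, hxy, true_and]
      split_ifs <;> simp_all
    · have hm : Mismatch y T' (x :: H) ↔ Mismatch y T H := by
        simp [Mismatch, ht, hxy]
      simp [hm, hxy, hy]
  omega

theorem Serves.interleave_le {n : ℕ} (κ K : ℕ) {T : BinaryTree (Fin n)} {S : List (Fin n)} {c : ℕ}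
    (h : Serves κ T S c) (hT : Ordered T) (H : List (Fin n)) :
    histSum (alternations K) H S ≤ 2 * c + mismatches K T H := by
  induction h generalizing H with
  | nil => simp [histSum]
  | @cons T T' x S k c ha _ ih =>
    have hT' : Ordered T' := by
      unfold Ordered at *
      rwa [ha.inorder_eq]
    have h1 := ha.alternations_le hT K H
    have h2 := ih hT' (x :: H)
    simp only [histSum]
    omega

/-- An empty history has no latest access, so the initial potential is zero whatever the tree. -/
theorem Serves.interleave_le_two_mul {n : ℕ} (κ K : ℕ) {T : BinaryTree (Fin n)}
    {S : List (Fin n)} {c : ℕ} (h : Serves κ T S c) (hT : Ordered T) :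
    histSum (alternations K) [] S ≤ 2 * c := by
  have := h.interleave_le κ K hT []
  simpa [mismatches, Mismatch] using this

theorem Serves.mul_length_le {α : Type} {κ c : ℕ} {T : BinaryTree α} {S : List α}
    (h : Serves κ T S c) : κ * S.length ≤ c := by
  induction h with
  | nil => simp
  | cons _ _ ih =>
    simp only [List.length_cons]
    linarith

/-! ### Move-to-root -/

/-- The part of a search tree with keys less than `z`. -/
def splitLt {n : ℕ} (z : Fin n) : BinaryTree (Fin n) → BinaryTree (Fin n)
  | .nil => .nil
  | .node k l r => if z = k then l else if z < k then splitLt z l else .node k l (splitLt z r)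

/-- The part of a search tree with keys greater than `z`. -/
def splitGt {n : ℕ} (z : Fin n) : BinaryTree (Fin n) → BinaryTree (Fin n)
  | .nil => .nil
  | .node k l r => if z = k then r else if z < k then .node k (splitGt z l) r else splitGt z r

/-- Rotating `z` past a parent hangs the parent on the side of `z` where it belongs, so the search
path is unzipped into its smaller and larger keys. -/
theorem moveToRoot_eq {n : ℕ} {z : Fin n} {t : BinaryTree (Fin n)} (ht : Ordered t)
    (hz : z ∈ inorder t) : moveToRoot z t = .node z (splitLt z t) (splitGt z t) := by
  induction t with
  | nil => simp [inorder] at hz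
  | node k l r ihl ihr =>
    rw [ordered_node] at ht
    obtain ⟨hl, hr, hlk, hkr⟩ := ht
    simp only [inorder, List.mem_append, List.mem_cons] at hz
    by_cases hzk : z = k
    · simp [moveToRoot, splitLt, splitGt, hzk]
    by_cases hlt : z < k
    · have hzl : z ∈ inorder l := by
        rcases hz with h | h | h
        · exact h
        · exact absurd h hzk
        · exact absurd hlt (hkr z h).asymm
      simp [moveToRoot, splitLt, splitGt, hzk, hlt, ihl hl hzl, rotateRight]
    · have hzr : z ∈ inorder r := by
        rcases hz with h | h | h
        · exact absurd (hlk z h) hlt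
        · exact absurd h hzk
        · exact h
      simp [moveToRoot, splitLt, splitGt, hzk, hlt, ihr hr hzr, rotateLeft]

theorem inorder_split {n : ℕ} {z : Fin n} {t : BinaryTree (Fin n)} (ht : Ordered t)
    (hz : z ∈ inorder t) : inorder (splitLt z t) ++ z :: inorder (splitGt z t) = inorder t := by
  induction t with
  | nil => simp [inorder] at hz
  | node k l r ihl ihr =>
    rw [ordered_node] at ht
    obtain ⟨hl, hr, hlk, hkr⟩ := ht
    simp only [inorder, List.mem_append, List.mem_cons] at hz
    by_cases hzk : z = k
    · simp [splitLt, splitGt, hzk, inorder]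
    by_cases hlt : z < k
    · have hzl : z ∈ inorder l := by
        rcases hz with h | h | h
        · exact h
        · exact absurd h hzk
        · exact absurd hlt (hkr z h).asymm
      simp [splitLt, splitGt, hzk, hlt, inorder, ← ihl hl hzl]
    · have hzr : z ∈ inorder r := by
        rcases hz with h | h | h
        · exact absurd (hlk z h) hlt
        · exact absurd h hzk
        · exact h
      simp [splitLt, splitGt, hzk, hlt, inorder, ← ihr hr hzr]

theorem IsBSTOn.moveToRoot {n : ℕ} {t : BinaryTree (Fin n)} (ht : IsBSTOn n t) (z : Fin n) :
    IsBSTOn n (moveToRoot z t) := by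
  have h := inorder_split ht.ordered (ht.mem z)
  rw [IsBSTOn, moveToRoot_eq ht.ordered (ht.mem z), inorder, h, ht]

/-- The proper ancestors of `x` in a search tree. -/
def ancestors {n : ℕ} (x : Fin n) : BinaryTree (Fin n) → Finset (Fin n)
  | .nil => ∅
  | .node k l r => if x = k then ∅ else if x < k then insert k (ancestors x l)
      else insert k (ancestors x r)

theorem mem_inorder_of_mem_ancestors {n : ℕ} {x y : Fin n} {t : BinaryTree (Fin n)}
    (h : y ∈ ancestors x t) : y ∈ inorder t := by
  induction t with
  | nil => simp [ancestors] at h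
  | node k l r ihl ihr =>
    simp only [ancestors] at h
    simp only [inorder, List.mem_append, List.mem_cons]
    split_ifs at h
    · simp at h
    · rcases Finset.mem_insert.1 h with h | h
      · tauto
      · exact Or.inl (ihl h)
    · rcases Finset.mem_insert.1 h with h | h
      · tauto
      · exact Or.inr (Or.inr (ihr h))

theorem depth_eq_card_ancestors {n : ℕ} (x : Fin n) {t : BinaryTree (Fin n)} (ht : Ordered t) :
    depth x t = (ancestors x t).card := by
  induction t with
  | nil => simp [depth, ancestors]
  | node k l r ihl ihr =>
    rw [ordered_node] at ht
    obtain ⟨hl, hr, hlk, hkr⟩ := ht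
    simp only [depth, ancestors]
    split_ifs
    · rfl
    · rw [Finset.card_insert_of_notMem, ihl hl]
      exact fun h => (hlk k (mem_inorder_of_mem_ancestors h)).false
    · rw [Finset.card_insert_of_notMem, ihr hr]
      exact fun h => (hkr k (mem_inorder_of_mem_ancestors h)).false

theorem ancestors_splitLt {n : ℕ} {x z : Fin n} (hxz : x < z) {t : BinaryTree (Fin n)}
    (ht : Ordered t) {y : Fin n} (hy : y ∈ ancestors x (splitLt z t)) :
    y ∈ ancestors x t ∧ y < z := by
  induction t with
  | nil => simp [splitLt, ancestors] at hy
  | node k l r ihl ihr =>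
    rw [ordered_node] at ht
    obtain ⟨hl, hr, hlk, hkr⟩ := ht
    simp only [splitLt] at hy
    split_ifs at hy with h1 h2
    · subst h1
      exact ⟨by simp [ancestors, hxz.ne, hxz, hy], hlk y (mem_inorder_of_mem_ancestors hy)⟩
    · have := ihl hl hy
      have hxk := hxz.trans h2
      exact ⟨by simp [ancestors, hxk.ne, hxk, this.1], this.2⟩
    · have hkz : k < z := lt_of_le_of_ne (not_lt.1 h2) (Ne.symm h1)
      simp only [ancestors] at hy ⊢
      split_ifs at hy ⊢ with h3 h4
      · simp at hy
      · rw [Finset.mem_insert] at hy ⊢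
        rcases hy with rfl | hy
        · exact ⟨Or.inl rfl, hkz⟩
        · exact ⟨Or.inr hy, (hlk y (mem_inorder_of_mem_ancestors hy)).trans hkz⟩
      · rw [Finset.mem_insert] at hy ⊢
        rcases hy with rfl | hy
        · exact ⟨Or.inl rfl, hkz⟩
        · exact ⟨Or.inr (ihr hr hy).1, (ihr hr hy).2⟩

theorem ancestors_splitGt {n : ℕ} {x z : Fin n} (hzx : z < x) {t : BinaryTree (Fin n)}
    (ht : Ordered t) {y : Fin n} (hy : y ∈ ancestors x (splitGt z t)) :
    y ∈ ancestors x t ∧ z < y := by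
  induction t with
  | nil => simp [splitGt, ancestors] at hy
  | node k l r ihl ihr =>
    rw [ordered_node] at ht
    obtain ⟨hl, hr, hlk, hkr⟩ := ht
    simp only [splitGt] at hy
    split_ifs at hy with h1 h2
    · subst h1
      exact ⟨by simp [ancestors, hzx.ne', hzx.asymm, hy], hkr y (mem_inorder_of_mem_ancestors hy)⟩
    · simp only [ancestors] at hy ⊢
      split_ifs at hy ⊢ with h3 h4
      · simp at hy
      · rw [Finset.mem_insert] at hy ⊢
        rcases hy with rfl | hy
        · exact ⟨Or.inl rfl, h2⟩
        · exact ⟨Or.inr (ihl hl hy).1, (ihl hl hy).2⟩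
      · rw [Finset.mem_insert] at hy ⊢
        rcases hy with rfl | hy
        · exact ⟨Or.inl rfl, h2⟩
        · exact ⟨Or.inr hy, h2.trans (hkr y (mem_inorder_of_mem_ancestors hy))⟩
    · have hkz : k < z := lt_of_le_of_ne (not_lt.1 h2) (Ne.symm h1)
      have := ihr hr hy
      have hxk := hkz.trans hzx
      exact ⟨by simp [ancestors, hxk.ne', hxk.asymm, this.1], this.2⟩

/-- Splitting at `z` creates no new ancestor relations on either side and destroys those across `z`;
only `z` itself is a new ancestor. -/
theorem mem_ancestors_moveToRoot {n : ℕ} {x z y : Fin n} {t : BinaryTree (Fin n)}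
    (ht : Ordered t) (hz : z ∈ inorder t) (hy : y ∈ ancestors x (moveToRoot z t)) :
    x ≠ z ∧ (y = z ∨ (y ∈ ancestors x t ∧ z ∉ Set.uIcc x y)) := by
  rw [moveToRoot_eq ht hz] at hy
  simp only [ancestors] at hy
  split_ifs at hy with h1 h2
  · simp at hy
  · refine ⟨h1, (Finset.mem_insert.1 hy).imp id fun h => ?_⟩
    obtain ⟨h3, h4⟩ := ancestors_splitLt h2 ht h
    exact ⟨h3, fun h => by rcases Set.mem_uIcc.1 h with h | h <;> omega⟩
  · have h2' : z < x := lt_of_le_of_ne (not_lt.1 h2) (Ne.symm h1)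
    refine ⟨h1, (Finset.mem_insert.1 hy).imp id fun h => ?_⟩
    obtain ⟨h3, h4⟩ := ancestors_splitGt h2' ht h
    exact ⟨h3, fun h => by rcases Set.mem_uIcc.1 h with h | h <;> omega⟩

/-- The tree after the accesses `H`, latest first. -/
def mtrTree {n : ℕ} (T : BinaryTree (Fin n)) : List (Fin n) → BinaryTree (Fin n)
  | [] => T
  | z :: H => moveToRoot z (mtrTree T H)

theorem IsBSTOn.mtrTree {n : ℕ} {T : BinaryTree (Fin n)} (hT : IsBSTOn n T) (H : List (Fin n)) :
    IsBSTOn n (mtrTree T H) := by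
  induction H with
  | nil => exact hT
  | cons z H ih => exact ih.moveToRoot z

theorem mtrCost_eq_histSum {n : ℕ} (κ : ℕ) (T : BinaryTree (Fin n)) (S H : List (Fin n)) :
    mtrCost κ (mtrTree T H) S = histSum (fun x H => κ + depth x (mtrTree T H)) H S := by
  induction S generalizing H with
  | nil => rfl
  | cons x S ih => simp only [mtrCost, histSum, ← ih]; rfl

/-! ### Recently accessed keys and the depth under Move-to-root -/

/-- The distinct keys accessed after the latest access to `x`, latest first, where `H` is the list
of the accesses, latest first. -/
def recent {α : Type*} [DecidableEq α] (x : α) : List α → List α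
  | [] => []
  | z :: H => if z = x then [] else z :: (recent x H).filter (· ≠ z)

theorem ne_of_mem_recent {α : Type*} [DecidableEq α] {x y : α} {H : List α}
    (h : y ∈ recent x H) : y ≠ x := by
  induction H with
  | nil => simp [recent] at h
  | cons z H ih =>
    simp only [recent] at h
    split_ifs at h with hz
    · simp at h
    · rcases List.mem_cons.1 h with rfl | h
      · exact hz
      · exact ih (List.mem_filter.1 h).1

theorem nodup_recent {α : Type*} [DecidableEq α] (x : α) (H : List α) : (recent x H).Nodup := by
  induction H with
  | nil => simp [recent]
  | cons z H ih =>
    simp only [recent]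
    split_ifs with hz
    · simp
    · rw [List.nodup_cons]
      exact ⟨by simp, ih.filter _⟩

theorem recent_map {α β : Type*} [DecidableEq α] [DecidableEq β] {f : α → β}
    (hf : Function.Injective f) (x : α) (H : List α) :
    recent (f x) (H.map f) = (recent x H).map f := by
  induction H with
  | nil => rfl
  | cons z H ih =>
    simp only [recent, List.map_cons, hf.eq_iff]
    split_ifs with hz
    · rfl
    · simp [ih, List.filter_map, Function.comp_def, hf.eq_iff]

/-- After the accesses `H`, latest first, the key `y` can be a proper ancestor of `x` only if no key
between them was accessed after `y`, or if `x` was not accessed at all. -/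
theorem mem_ancestors_mtrTree {n : ℕ} {T : BinaryTree (Fin n)} (hT : IsBSTOn n T) {x y : Fin n}
    {H : List (Fin n)} (hy : y ∈ ancestors x (mtrTree T H)) :
    (∃ B A, recent x H = B ++ y :: A ∧ ∀ b ∈ B, b ∉ Set.uIcc x y) ∨
      (x ∉ H ∧ y ∈ ancestors x T) := by
  induction H with
  | nil => exact Or.inr ⟨by simp, hy⟩
  | cons z H ih =>
    have hb := hT.mtrTree H
    obtain ⟨hxz, h⟩ := mem_ancestors_moveToRoot hb.ordered (hb.mem z) hy
    by_cases hyz : y = z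
    · subst hyz
      exact Or.inl ⟨[], _, by simp only [recent, hxz.symm, if_false, List.nil_append]; rfl,
        by simp⟩
    have h := h.resolve_left hyz
    rcases ih h.1 with ⟨B, A, h1, h2⟩ | ⟨h1, h2⟩
    · refine Or.inl ⟨z :: B.filter (· ≠ z), A.filter (· ≠ z), ?_, ?_⟩
      · simp [recent, hxz.symm, h1, hyz]
      · intro b hb
        rcases List.mem_cons.1 hb with rfl | hb
        · exact h.2
        · exact h2 b (List.mem_filter.1 hb).1
    · exact Or.inr ⟨by simp [hxz, h1], h2⟩

open Classical in
/-- The number of elements `y` of a list that are separated from `x` by no earlier element. -/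
noncomputable def exposed {n : ℕ} (x : Fin n) (L : List (Fin n)) : ℕ :=
  ((Finset.range L.length).filter fun i => ∃ y, L[i]? = some y ∧
    ∀ b ∈ L.take i, b ∉ Set.uIcc x y).card

/-- Every proper ancestor is either an exposed recent key, identified by its position, or an initial
ancestor of a key not accessed so far. -/
theorem depth_mtrTree_le {n : ℕ} {T : BinaryTree (Fin n)} (hT : IsBSTOn n T) (x : Fin n)
    (H : List (Fin n)) :
    depth x (mtrTree T H) ≤ exposed x (recent x H) + if x ∈ H then 0 else depth x T := by
  classical
  rw [depth_eq_card_ancestors x (hT.mtrTree H).ordered, depth_eq_card_ancestors x hT.ordered]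
  set I := (Finset.range (recent x H).length).filter fun i => ∃ y, (recent x H)[i]? = some y ∧
    ∀ b ∈ (recent x H).take i, b ∉ Set.uIcc x y with hI
  have h : ancestors x (mtrTree T H) ⊆ I.image (fun i => ((recent x H)[i]?).getD x) ∪
      if x ∈ H then ∅ else ancestors x T := by
    intro y hy
    rw [Finset.mem_union]
    rcases mem_ancestors_mtrTree hT hy with ⟨B, A, h1, h2⟩ | ⟨h1, h2⟩
    · refine Or.inl (Finset.mem_image.2 ⟨B.length, ?_, by simp [h1]⟩)
      rw [hI, Finset.mem_filter]
      simpa [h1] using h2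
    · simp [h1, h2]
  refine (Finset.card_le_card h).trans ((Finset.card_union_le _ _).trans ?_)
  refine add_le_add ?_ (by split_ifs <;> simp)
  refine Finset.card_image_le.trans (le_of_eq ?_)
  unfold exposed
  rw [hI]

/-! ### Move-to-root in the dynamic BST model -/

theorem Steps.trans {α : Type} {j k : ℕ} {P Q R : Pointed α} (h : Steps j P Q)
    (h' : Steps k Q R) : Steps (j + k) P R := by
  induction h' with
  | refl => exact h
  | tail _ hs ih => exact .tail (ih h) hs

theorem Step.steps {α : Type} {P Q : Pointed α} (h : Step P Q) : Steps 1 P Q :=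
  .tail (.refl P) h

/-- Walk down to `x` and rotate it back up, one operation per edge each way. The context `c` is
arbitrary so that the induction can enter a subtree. -/
theorem exists_steps_moveToRoot {n : ℕ} {x : Fin n} {t : BinaryTree (Fin n)} (ht : Ordered t)
    (hx : x ∈ inorder t) (c : List (Frame (Fin n))) :
    ∃ P : Pointed (Fin n), Steps (depth x t) ⟨c, t⟩ P ∧ P.IsAt x ∧
      Steps (depth x t) P ⟨c, moveToRoot x t⟩ := by
  induction t generalizing c with
  | nil => simp [inorder] at hx
  | node k l r ihl ihr =>
    rw [ordered_node] at ht
    obtain ⟨hl, hr, hlk, hkr⟩ := ht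
    simp only [inorder, List.mem_append, List.mem_cons] at hx
    by_cases hxk : x = k
    · subst hxk
      simp only [depth, moveToRoot, if_true]
      exact ⟨⟨c, .node x l r⟩, .refl _, ⟨l, r, rfl⟩, .refl _⟩
    by_cases hlt : x < k
    · have hxl : x ∈ inorder l := by
        rcases hx with h | h | h
        · exact h
        · exact absurd h hxk
        · exact absurd hlt (hkr x h).asymm
      obtain ⟨P, h1, h2, h3⟩ := ihl hl hxl (.fromLeft k r :: c)
      simp only [depth, moveToRoot, hxk, hlt, if_false, if_true]
      -- A rotation needs a visible node at the pointer, which the split form supplies.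
      rw [moveToRoot_eq hl hxl] at h3 ⊢
      refine ⟨P, ?_, h2, .tail h3 (.rotateUpLeft ..)⟩
      cases l with
      | nil => simp [inorder] at hxl
      | node y a b => rw [add_comm]; exact (Step.moveLeft ..).steps.trans h1
    · have hxr : x ∈ inorder r := by
        rcases hx with h | h | h
        · exact absurd (hlk x h) hlt
        · exact absurd h hxk
        · exact h
      obtain ⟨P, h1, h2, h3⟩ := ihr hr hxr (.fromRight k l :: c)
      simp only [depth, moveToRoot, hxk, hlt, if_false]
      rw [moveToRoot_eq hr hxr] at h3 ⊢
      refine ⟨P, ?_, h2, .tail h3 (.rotateUpRight ..)⟩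
      cases r with
      | nil => simp [inorder] at hxr
      | node y a b => rw [add_comm]; exact (Step.moveRight ..).steps.trans h1

theorem exists_serves_le_mtrCost {n : ℕ} (κ : ℕ) {T : BinaryTree (Fin n)} (hT : IsBSTOn n T)
    (S : List (Fin n)) : ∃ c, Serves κ T S c ∧ c ≤ 2 * mtrCost κ T S := by
  induction S generalizing T with
  | nil => exact ⟨0, .nil T, by simp⟩
  | cons x S ih =>
    obtain ⟨c, hc, hle⟩ := ih (hT.moveToRoot x)
    obtain ⟨P, h1, h2, h3⟩ := exists_steps_moveToRoot hT.ordered (hT.mem x) []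
    have ha : Access T x (depth x T + depth x T) (moveToRoot x T) :=
      ⟨_, _, P, _, h1, h2, h3, rfl, rfl⟩
    refine ⟨_, .cons ha hc, ?_⟩
    simp only [mtrCost]
    omega

theorem optCost_le_two_mul_mtrCost {n : ℕ} (κ : ℕ) {T : BinaryTree (Fin n)} (hT : IsBSTOn n T)
    (S : List (Fin n)) : optCost κ S ≤ 2 * mtrCost κ T S := by
  obtain ⟨c, hc, hle⟩ := exists_serves_le_mtrCost κ hT S
  exact le_trans (Nat.sInf_le (m := c) ⟨T, hT, hc⟩) hle

theorem exists_serves_optCost {n : ℕ} (κ : ℕ) {T : BinaryTree (Fin n)} (hT : IsBSTOn n T)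
    (S : List (Fin n)) : ∃ T', IsBSTOn n T' ∧ Serves κ T' S (optCost κ S) := by
  obtain ⟨c, hc, -⟩ := exists_serves_le_mtrCost κ hT S
  have hne : {c | ∃ T : BinaryTree (Fin n), IsBSTOn n T ∧ Serves κ T S c}.Nonempty :=
    ⟨c, T, hT, hc⟩
  exact Nat.sInf_mem hne

/-! ### Sums over histories and the working set bound -/

theorem histSum_mono {α : Type*} {F G : α → List α → ℝ} (h : ∀ x H, F x H ≤ G x H)
    (H S : List α) : histSum F H S ≤ histSum G H S := by
  induction S generalizing H with
  | nil => exact le_rfl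
  | cons x S ih => exact add_le_add (h x H) (ih _)

theorem histSum_add {α : Type*} (F G : α → List α → ℝ) (H S : List α) :
    histSum (fun x H => F x H + G x H) H S = histSum F H S + histSum G H S := by
  induction S generalizing H with
  | nil => simp [histSum]
  | cons x S ih => simp only [histSum, ih]; ring

theorem histSum_mul {α : Type*} (c : ℝ) (F : α → List α → ℝ) (H S : List α) :
    histSum (fun x H => c * F x H) H S = c * histSum F H S := by
  induction S generalizing H with
  | nil => simp [histSum]
  | cons x S ih => simp only [histSum, ih]; ring

theorem histSum_const {α : Type*} (c : ℝ) (H S : List α) :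
    histSum (fun _ _ => c) H S = c * S.length := by
  induction S generalizing H with
  | nil => simp [histSum]
  | cons x S ih => simp only [histSum, ih, List.length_cons]; push_cast; ring

theorem histSum_map {α β M : Type*} [AddMonoid M] (F : β → List β → M) (f : α → β)
    (H S : List α) :
    histSum F (H.map f) (S.map f) = histSum (fun x H => F (f x) (H.map f)) H S := by
  induction S generalizing H with
  | nil => rfl
  | cons x S ih => simp only [histSum, List.map_cons, ← ih]

theorem cast_histSum {α : Type*} (F : α → List α → ℕ) (H S : List α) :
    ((histSum F H S : ℕ) : ℝ) = histSum (fun x H => (F x H : ℝ)) H S := by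
  induction S generalizing H with
  | nil => simp [histSum]
  | cons x S ih => simp [histSum, ih]

theorem sum_histSum {α ι : Type*} (s : Finset ι) (F : ι → α → List α → ℝ) (H S : List α) :
    ∑ i ∈ s, histSum (F i) H S = histSum (fun x H => ∑ i ∈ s, F i x H) H S := by
  induction S generalizing H with
  | nil => simp [histSum]
  | cons x S ih => simp only [histSum, Finset.sum_add_distrib, ih]

theorem sum_get_eq_histSum {α M : Type*} [AddCommMonoid M] (F : α → List α → M) (H S : List α) :
    ∑ j : Fin S.length, F (S.get j) ((S.take j).reverse ++ H) = histSum F H S := by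
  induction S generalizing H with
  | nil => simp [histSum]
  | cons x S ih =>
    simp only [List.length_cons, Fin.sum_univ_succ, histSum, ← ih]
    simp

theorem mem_recent_reverse_take {α : Type*} [DecidableEq α] (S : List α) (x y : α) (j : ℕ)
    (hj : j ≤ S.length) :
    y ∈ recent x (S.take j).reverse ↔ ∃ (i : ℕ) (hi : i < S.length), i < j ∧ S[i] = y ∧
      ∀ (k : ℕ) (hk : k < S.length), k < j → i ≤ k → S[k] ≠ x := by
  induction j with
  | zero => simp [recent]
  | succ j ih =>
    have hj' : j < S.length := hj
    rw [List.take_succ_eq_append_getElem hj', List.reverse_append, List.reverse_singleton,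
      List.singleton_append, recent]
    split_ifs with hx
    · simp only [List.not_mem_nil, false_iff]
      rintro ⟨i, hi, hij, -, h⟩
      exact h j hj' (Nat.lt_succ_self j) (Nat.lt_succ_iff.1 hij) hx
    · have hmem : y ∈ S[j] :: (recent x (S.take j).reverse).filter (· ≠ S[j]) ↔
          y = S[j] ∨ y ∈ recent x (S.take j).reverse := by
        simp only [List.mem_cons, List.mem_filter, decide_eq_true_eq]
        tauto
      rw [hmem, ih hj'.le]
      constructor
      · rintro (rfl | ⟨i, hi, hij, hiy, h⟩)
        · refine ⟨j, hj', Nat.lt_succ_self j, rfl, fun k hk hkj hjk => ?_⟩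
          obtain rfl : k = j := by omega
          exact hx
        · refine ⟨i, hi, by omega, hiy, fun k hk hkj hik => ?_⟩
          rcases Nat.lt_succ_iff_lt_or_eq.1 hkj with hkj | rfl
          · exact h k hk hkj hik
          · exact hx
      · rintro ⟨i, hi, hij, hiy, h⟩
        rcases Nat.lt_succ_iff_lt_or_eq.1 hij with hij | rfl
        · exact Or.inr ⟨i, hi, hij, hiy, fun k hk hkj hik => h k hk (by omega) hik⟩
        · exact Or.inl hiy.symm

theorem workingSet_eq {n : ℕ} (S : List (Fin n)) (j : Fin S.length) :
    workingSet S j = insert (S.get j) (recent (S.get j) (S.take j).reverse).toFinset := by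
  ext y
  rw [Finset.mem_insert, List.mem_toFinset, mem_recent_reverse_take _ _ _ _ j.2.le]
  simp only [workingSet, Finset.mem_image, Finset.mem_filter, Finset.mem_univ, true_and,
    List.get_eq_getElem]
  constructor
  · rintro ⟨i, ⟨hij, h⟩, rfl⟩
    rcases hij.lt_or_eq with hij | rfl
    · exact Or.inr ⟨i, i.2, hij, rfl, fun k hk hkj hik hkx => (h ⟨k, hk⟩ hkj hkx).not_ge hik⟩
    · exact Or.inl rfl
  · rintro (rfl | ⟨i, hi, hij, rfl, h⟩)
    · exact ⟨j, ⟨le_rfl, fun k hk _ => hk⟩, rfl⟩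
    · refine ⟨⟨i, hi⟩, ⟨le_of_lt hij, fun k hkj hkx => ?_⟩, rfl⟩
      by_contra hik
      exact h k k.2 hkj (not_lt.1 hik) hkx

/-- The logarithm of the size of the working set of an access to `x` after the accesses `H`. -/
noncomputable def logWorkingSet {n : ℕ} (x : Fin n) (H : List (Fin n)) : ℝ :=
  Real.logb 2 ((recent x H).length + 1)

theorem logWorkingSet_nonneg {n : ℕ} (x : Fin n) (H : List (Fin n)) : 0 ≤ logWorkingSet x H :=
  Real.logb_nonneg one_lt_two (by simp)

theorem WS_eq_histSum {n : ℕ} (S : List (Fin n)) : WS S = histSum logWorkingSet [] S := by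
  rw [← sum_get_eq_histSum, WS]
  refine Finset.sum_congr rfl fun j _ => ?_
  rw [workingSet_eq, Finset.card_insert_of_notMem, List.toFinset_card_of_nodup (nodup_recent _ _),
    logWorkingSet, List.append_nil]
  · push_cast
    rfl
  · rw [List.mem_toFinset]
    exact fun h => ne_of_mem_recent h rfl

/-- A key is charged only at its first access, so each initial depth is paid at most once. -/
theorem histSum_first_le {n : ℕ} (d : Fin n → ℝ) (hd : ∀ i, 0 ≤ d i) (H S : List (Fin n)) :
    histSum (fun x H => if x ∈ H then 0 else d x) H S ≤ ∑ i with i ∉ H, d i := by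
  induction S generalizing H with
  | nil => exact Finset.sum_nonneg fun i _ => hd i
  | cons x S ih =>
    simp only [histSum]
    refine (add_le_add_right (ih (x :: H)) _).trans ?_
    split_ifs with hx
    · rw [zero_add]
      refine Finset.sum_le_sum_of_subset_of_nonneg ?_ fun i _ _ => hd i
      intro i
      simp
    · rw [← Finset.sum_insert (s := {i | i ∉ x :: H}) (by simp)]
      refine Finset.sum_le_sum_of_subset_of_nonneg ?_ fun i _ _ => hd i
      intro i
      simp only [Finset.mem_insert, Finset.mem_filter, Finset.mem_univ, true_and, List.mem_cons]
      rintro (rfl | h)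
      · exact hx
      · tauto

theorem toFinset_recent {α : Type*} [DecidableEq α] {x : α} {H : List α} (hx : x ∉ H) :
    (recent x H).toFinset = H.toFinset := by
  induction H with
  | nil => rfl
  | cons z H ih =>
    rw [List.mem_cons, not_or] at hx
    ext y
    have := Finset.ext_iff.1 (ih hx.2) y
    simp only [List.mem_toFinset] at this
    simp only [recent, Ne.symm hx.1, if_false, List.mem_toFinset, List.mem_cons,
      List.mem_filter, this, decide_eq_true_eq]
    tauto

/-- The first access to a new key, after `h` distinct ones, has a working set of size `h + 1`; these
factors multiply to a quotient of factorials. -/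
theorem logb_factorial_le {n : ℕ} (H S : List (Fin n)) :
    Real.logb 2 ((H.toFinset ∪ S.toFinset).card.factorial) ≤
      Real.logb 2 (H.toFinset.card.factorial) + histSum logWorkingSet H S := by
  induction S generalizing H with
  | nil => simp [histSum]
  | cons x S ih =>
    have h := ih (x :: H)
    have hU : (x :: H).toFinset ∪ S.toFinset = H.toFinset ∪ (x :: S).toFinset := by
      ext; simp
    rw [hU] at h
    refine h.trans ?_
    simp only [histSum, ← add_assoc]
    refine add_le_add_left ?_ _
    by_cases hx : x ∈ H
    · have : (x :: H).toFinset = H.toFinset := by ext; simp; rintro rfl; exact hx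
      rw [this]
      linarith [logWorkingSet_nonneg x H]
    · rw [List.toFinset_cons, Finset.card_insert_of_notMem (by simpa using hx),
        Nat.factorial_succ, logWorkingSet, ← List.toFinset_card_of_nodup (nodup_recent _ _),
        toFinset_recent hx, Nat.cast_mul, Real.logb_mul (by positivity) (by positivity), add_comm]
      push_cast
      rfl

/-- Pair the factors `i + 1` and `n - i`: each product is at least `n`. This stands in for
Stirling's formula. -/
theorem pow_self_le_factorial_sq (n : ℕ) : n ^ n ≤ n.factorial ^ 2 := by
  have h : n.factorial ^ 2 = ∏ i ∈ Finset.range n, (i + 1) * (n - 1 - i + 1) := by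
    rw [Finset.prod_mul_distrib, Finset.prod_range_reflect (fun i => i + 1),
      Finset.prod_range_add_one_eq_factorial, sq]
  rw [h]
  calc n ^ n = ∏ _i ∈ Finset.range n, n := by simp
    _ ≤ _ := by
      refine Finset.prod_le_prod' fun i hi => ?_
      obtain ⟨j, rfl⟩ := Nat.exists_eq_add_of_lt (Finset.mem_range.1 hi)
      have : i + j + 1 - 1 - i = j := by omega
      rw [this]
      nlinarith [Nat.zero_le (i * j)]

theorem mul_logb_le_two_mul_WS {n : ℕ} {S : List (Fin n)} (hS : ∀ i, i ∈ S) :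
    n * Real.logb 2 n ≤ 2 * WS S := by
  have h := logb_factorial_le [] S
  have hu : S.toFinset = Finset.univ := by ext; simp [hS]
  rw [← WS_eq_histSum, hu] at h
  simp only [List.toFinset_nil, Finset.empty_union, Finset.card_univ, Fintype.card_fin,
    Finset.card_empty, Nat.factorial_zero, Nat.cast_one, Real.logb_one, zero_add] at h
  rcases Nat.eq_zero_or_pos n with rfl | hn
  · simp only [Nat.factorial_zero, Nat.cast_one, Real.logb_one] at h
    simpa using h
  have h2 : Real.logb 2 ((n : ℝ) ^ n) ≤ Real.logb 2 ((n.factorial : ℝ) ^ 2) :=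
    Real.logb_le_logb_of_le one_lt_two (by positivity) (by exact_mod_cast pow_self_le_factorial_sq n)
  rw [Real.logb_pow, Real.logb_pow] at h2
  push_cast at h2
  linarith

/-! ### Random relabelling -/

/-- Exchangeability: composing with a transposition permutes the relabellings, so all keys of `Z`
have the same total, which can be found by counting over `Z` for a fixed relabelling. -/
theorem card_mul_sum_perm {n : ℕ} {g : Equiv.Perm (Fin n) → Fin n → ℕ} {Z : Finset (Fin n)}
    {y : Fin n} (hg : ∀ v ∈ Z, ∀ π, g (π * Equiv.swap y v) y = g π v) :
    Z.card * ∑ π, g π y = ∑ π, ∑ v ∈ Z, g π v := by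
  rw [Finset.sum_comm, ← smul_eq_mul, ← Finset.sum_const]
  refine Finset.sum_congr rfl fun v hv => ?_
  simp_rw [← hg v hv]
  exact (Equiv.sum_comp (Equiv.mulRight (Equiv.swap y v)) fun π => g π y).symm

theorem swap_mem_iff {n : ℕ} {Z : Finset (Fin n)} {y v : Fin n} (hy : y ∈ Z) (hv : v ∈ Z)
    (d : Fin n) : Equiv.swap y v d ∈ Z ↔ d ∈ Z := by
  rcases eq_or_ne d y with rfl | h1
  · simp [hy, hv]
  rcases eq_or_ne d v with rfl | h2
  · simp [hy, hv]
  rw [Equiv.swap_apply_of_ne_of_ne h1 h2]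

-- On either side of `π x` at most one key of `Z` can be nearest.
open Classical in
theorem card_nearest_le_two {n : ℕ} (x : Fin n) (Z : Finset (Fin n)) (hx : x ∉ Z)
    (π : Equiv.Perm (Fin n)) :
    (Z.filter fun v => ∀ d ∈ Z, d ≠ v → π d ∉ Set.uIcc (π x) (π v)).card ≤ 2 := by
  set W := Z.filter fun v => ∀ d ∈ Z, d ≠ v → π d ∉ Set.uIcc (π x) (π v) with hW
  rw [← Finset.card_filter_add_card_filter_not (s := W) (fun v => π v < π x)]
  have h : ∀ a ∈ W, ∀ b ∈ W, (π a < π x ↔ π b < π x) → a = b := by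
    intro a ha b hb hab
    rw [hW, Finset.mem_filter] at ha hb
    by_contra hne
    have h1 := ha.2 b hb.1 (Ne.symm hne)
    have h2 := hb.2 a ha.1 hne
    have h3 : π a ≠ π x := fun h => hx (π.injective h ▸ ha.1)
    have h4 : π b ≠ π x := fun h => hx (π.injective h ▸ hb.1)
    rw [Set.mem_uIcc] at h1 h2
    omega
  have h1 : (W.filter fun v => π v < π x).card ≤ 1 := by
    rw [Finset.card_le_one]
    intro a ha b hb
    rw [Finset.mem_filter] at ha hb
    exact h a ha.1 b hb.1 (by tauto)
  have h2 : (W.filter fun v => ¬ π v < π x).card ≤ 1 := by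
    rw [Finset.card_le_one]
    intro a ha b hb
    rw [Finset.mem_filter] at ha hb
    exact h a ha.1 b hb.1 (by tauto)
  omega

open Classical in
theorem card_mul_card_nearest_le {n : ℕ} {x y : Fin n} {Z : Finset (Fin n)} (hx : x ∉ Z)
    (hy : y ∈ Z) :
    Z.card * ∑ π : Equiv.Perm (Fin n),
      (if ∀ d ∈ Z, d ≠ y → π d ∉ Set.uIcc (π x) (π y) then 1 else 0) ≤ 2 * n.factorial := by
  rw [card_mul_sum_perm (y := y)
    (g := fun π v => if ∀ d ∈ Z, d ≠ v → π d ∉ Set.uIcc (π x) (π v) then 1 else 0)]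
  · calc _ ≤ ∑ _π : Equiv.Perm (Fin n), 2 := Finset.sum_le_sum fun π _ => by
          rw [← Finset.card_filter]
          exact card_nearest_le_two x Z hx π
      _ = _ := by simp [Fintype.card_perm, mul_comm]
  · intro v hv π
    have hxy : x ≠ y := fun h => hx (h ▸ hy)
    have hxv : x ≠ v := fun h => hx (h ▸ hv)
    refine if_congr ?_ rfl rfl
    simp only [Equiv.Perm.mul_apply, Equiv.swap_apply_left,
      Equiv.swap_apply_of_ne_of_ne hxy hxv]
    constructor
    · intro h d hd hdv
      have := h (Equiv.swap y v d) ((swap_mem_iff hy hv d).2 hd)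
        (by rw [Ne, Equiv.swap_apply_eq_iff, Equiv.swap_apply_left]; exact hdv)
      rwa [Equiv.swap_apply_self] at this
    · intro h d hd hdy
      exact h _ ((swap_mem_iff hy hv d).2 hd)
        (by rw [Ne, Equiv.swap_apply_eq_iff, Equiv.swap_apply_right]; exact hdy)

/-- Termwise, `2 / (m + 1) ≤ 4 / (m + 2)`, and `1 / (m + 2)` is at most the increment of the natural
logarithm, hence of the binary one because `log 2 ≤ 1`. -/
theorem sum_two_div_le (m : ℕ) :
    ∑ i ∈ Finset.range m, (2 : ℝ) / (i + 1) ≤ 4 * Real.logb 2 (m + 1) := by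
  induction m with
  | zero => simp
  | succ m ih =>
    rw [Finset.sum_range_succ]
    push_cast
    have h1 := Real.one_sub_inv_le_log_of_pos (x := ((m : ℝ) + 1 + 1) / (m + 1)) (by positivity)
    rw [Real.log_div (by positivity) (by positivity), inv_div] at h1
    have h2 : 1 - ((m : ℝ) + 1) / (m + 1 + 1) = 1 / (m + 1 + 1) := by field_simp; ring
    have h3 : (2 : ℝ) / (m + 1) ≤ 4 * (1 / (m + 1 + 1)) := by
      rw [mul_one_div, div_le_div_iff₀ (by positivity) (by positivity)]
      nlinarith [Nat.cast_nonneg (α := ℝ) m]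
    have h4 : Real.log (m + 1 + 1) - Real.log (m + 1) ≤
        Real.logb 2 (m + 1 + 1) - Real.logb 2 (m + 1) := by
      have hl : Real.log 2 ≤ 1 := by linarith [Real.log_two_lt_d9]
      rw [Real.logb, Real.logb, ← sub_div]
      refine le_div_self ?_ (Real.log_pos one_lt_two) hl
      rw [sub_nonneg]
      exact Real.log_le_log (by positivity) (by linarith)
    linarith

/-- The entry at index `i` is exposed only if it is nearest to `x` on its side among the first `i +
1` entries, an event of probability at most `2 / (i + 1)`. -/
theorem sum_exposed_le {n : ℕ} {x : Fin n} {L : List (Fin n)} (hL : L.Nodup) (hx : x ∉ L) :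
    ∑ π : Equiv.Perm (Fin n), (exposed (π x) (L.map π) : ℝ) ≤
      n.factorial * (4 * Real.logb 2 (L.length + 1)) := by
  classical
  refine le_trans ?_ (mul_le_mul_of_nonneg_left (sum_two_div_le L.length) (by positivity))
  have h : ∀ π : Equiv.Perm (Fin n), (exposed (π x) (L.map π) : ℝ) =
      ∑ i ∈ Finset.range L.length, if ∃ y, (L.map π)[i]? = some y ∧
        ∀ b ∈ (L.map π).take i, b ∉ Set.uIcc (π x) y then (1 : ℝ) else 0 := by
    intro π
    unfold exposed
    rw [Finset.sum_boole, List.length_map]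
  simp_rw [h]
  rw [Finset.sum_comm, Finset.mul_sum]
  refine Finset.sum_le_sum fun i hi => ?_
  have hi := Finset.mem_range.1 hi
  set Z := (L.take (i + 1)).toFinset with hZ
  have hyZ : L[i] ∈ Z := by
    rw [hZ, List.mem_toFinset, List.take_succ_eq_append_getElem hi]
    exact List.mem_append_right _ (List.mem_singleton_self _)
  have hxZ : x ∉ Z := fun h => hx (List.mem_of_mem_take (List.mem_toFinset.1 h))
  have hcard : Z.card = i + 1 := by
    rw [hZ, List.toFinset_card_of_nodup (hL.sublist (List.take_sublist _ _)), List.length_take]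
    omega
  have hb := card_mul_card_nearest_le hxZ hyZ
  rw [hcard] at hb
  have hb' : ((i : ℝ) + 1) * ∑ π : Equiv.Perm (Fin n),
      (if ∀ d ∈ Z, d ≠ L[i] → π d ∉ Set.uIcc (π x) (π L[i]) then (1 : ℝ) else 0) ≤
      2 * n.factorial := by exact_mod_cast hb
  rw [mul_div_assoc', le_div_iff₀ (by positivity), mul_comm, mul_comm _ (2 : ℝ)]
  refine le_trans (mul_le_mul_of_nonneg_left (Finset.sum_le_sum fun π _ => ?_) (by positivity)) hb'
  have himp : (∃ y, (L.map π)[i]? = some y ∧ ∀ b ∈ (L.map π).take i, b ∉ Set.uIcc (π x) y) →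
      ∀ d ∈ Z, d ≠ L[i] → π d ∉ Set.uIcc (π x) (π L[i]) := by
    rintro ⟨y, hy, hyb⟩ d hd hdi
    simp only [List.getElem?_map, List.getElem?_eq_getElem hi, Option.map_some,
      Option.some_inj] at hy
    subst hy
    refine hyb _ ?_
    rw [← List.map_take]
    refine List.mem_map_of_mem ?_
    rw [hZ, List.mem_toFinset, List.take_succ_eq_append_getElem hi, List.mem_append,
      List.mem_singleton] at hd
    exact hd.resolve_right hdi
  split_ifs with h1 h2 h2
  · exact le_rfl
  · exact absurd (himp h1) h2
  · exact zero_le_one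
  · exact le_rfl

theorem sum_mtrCost_le {n : ℕ} (κ : ℕ) {T : BinaryTree (Fin n)} (hT : IsBSTOn n T)
    (S : List (Fin n)) :
    ∑ π : Equiv.Perm (Fin n), (mtrCost κ T (S.map π) : ℝ) ≤
      n.factorial * (κ * S.length + 4 * WS S + ∑ i, (depth i T : ℝ)) := by
  have h1 : ∀ π : Equiv.Perm (Fin n), (mtrCost κ T (S.map π) : ℝ) ≤
      histSum (fun x H => (exposed (π x) ((recent x H).map π) : ℝ)) [] S +
        (κ * S.length + ∑ i, (depth i T : ℝ)) := by
    intro π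
    have h := mtrCost_eq_histSum κ T (S.map π) []
    have hm := histSum_map (fun x H => κ + depth x (mtrTree T H)) π [] S
    rw [List.map_nil] at hm
    rw [mtrTree] at h
    rw [h, hm, cast_histSum]
    have h2 : histSum (fun x H => ((κ + depth (π x) (mtrTree T (H.map π)) : ℕ) : ℝ)) [] S ≤
        histSum (fun x H => (exposed (π x) ((recent x H).map π) : ℝ) +
          ((κ : ℝ) + if x ∈ H then 0 else (depth (π x) T : ℝ))) [] S := by
      refine histSum_mono (fun x H => ?_) _ _
      have h3 := depth_mtrTree_le hT (π x) (H.map π)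
      simp only [recent_map π.injective, List.mem_map_of_injective π.injective] at h3
      have h4 : ((depth (π x) (mtrTree T (H.map π)) : ℕ) : ℝ) ≤
          (exposed (π x) ((recent x H).map π) : ℝ) + if x ∈ H then 0 else (depth (π x) T : ℝ) := by
        exact_mod_cast h3
      push_cast
      linarith
    refine h2.trans ?_
    rw [histSum_add, histSum_add, histSum_const]
    have h5 := histSum_first_le (fun i => (depth (π i) T : ℝ)) (fun _ => by positivity) [] S
    simp only [List.not_mem_nil, not_false_eq_true, Finset.filter_true] at h5
    -- The total of all initial depths does not depend on the relabelling.
    rw [Equiv.sum_comp π (fun i => (depth i T : ℝ))] at h5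
    linarith
  refine (Finset.sum_le_sum fun π _ => h1 π).trans ?_
  rw [Finset.sum_add_distrib, sum_histSum]
  have h6 : histSum (fun x H => ∑ π : Equiv.Perm (Fin n),
      (exposed (π x) ((recent x H).map π) : ℝ)) [] S ≤
      n.factorial * (4 * WS S) := by
    rw [WS_eq_histSum, ← histSum_mul, ← histSum_mul]
    exact histSum_mono (fun x H =>
      sum_exposed_le (nodup_recent x H) fun h => ne_of_mem_recent h rfl) _ _
  simp only [Finset.sum_const, Finset.card_univ, Fintype.card_perm, Fintype.card_fin, nsmul_eq_mul]
  linarith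

/-! ### Lower bound for the expected number of alternations -/

theorem find?_of_find?_recent {α : Type*} [DecidableEq α] {p : α → Bool} {x b : α} {H : List α}
    (h : (recent x H).find? p = some b) : H.find? p = some b := by
  induction H with
  | nil => simp [recent] at h
  | cons z H ih =>
    simp only [recent] at h
    split_ifs at h
    · simp at h
    by_cases hz : p z = true
    · simpa [hz] using h
    · rw [List.find?_cons_of_neg hz] at h ⊢
      refine ih ?_
      rw [← h, List.find?_filter]
      congr 1
      funext a
      rcases eq_or_ne a z with rfl | ha
      · simpa using hz
      · simp [ha]

/-- The key `b` lies in the block of size `2 ^ (k + 1)` around `a`. -/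
def SameBlock {n : ℕ} (k : ℕ) (a b : Fin n) : Prop := half (k + 1) b = half (k + 1) a

/-- The key `b` lies in the half of the block of size `2 ^ (k + 1)` around `a` opposite to `a`. -/
def Opposite {n : ℕ} (k : ℕ) (a b : Fin n) : Prop := SameBlock k a b ∧ half k b ≠ half k a

/-- Recent keys are listed by their latest access. The only one among the first `t` that lies in the
block around `x` is therefore the latest access to that block. -/
theorem alternates_of_opposite {n k : ℕ} {x z : Fin n} {H : List (Fin n)} {t : ℕ}
    (hz : z ∈ (recent x H).take t) (hxz : Opposite k x z)
    (h : ∀ a ∈ (recent x H).take t, a ≠ z → ¬ SameBlock k x a) : Alternates k x H := by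
  refine ⟨z, find?_of_find?_recent (x := x) ?_, hxz.2⟩
  have hsome : (((recent x H).take t).find? (inBlock (k, half (k + 1) x))).isSome = true := by
    rw [List.find?_isSome]
    exact ⟨z, hz, inBlock_iff.2 hxz.1⟩
  obtain ⟨b, hb⟩ := Option.isSome_iff_exists.1 hsome
  have hbz : b = z := by
    by_contra hne
    exact h b (List.mem_of_find?_eq_some hb) hne (inBlock_iff.1 (List.find?_some hb))
  rw [← List.take_append_drop t (recent x H), List.find?_append, hb, hbz, Option.some_or]

open Classical in
theorem card_half_le {n : ℕ} (j q : ℕ) :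
    (Finset.univ.filter fun b : Fin n => half j b = q).card ≤ 2 ^ j := by
  have h : (Finset.univ.filter fun b : Fin n => half j b = q).card ≤
      (Finset.Ico (2 ^ j * q) (2 ^ j * q + 2 ^ j)).card := by
    refine Finset.card_le_card_of_injOn Fin.val ?_ Fin.val_injective.injOn
    intro b hb
    have hb : b.val / 2 ^ j = q := (Finset.mem_filter.1 (Finset.mem_coe.1 hb)).2
    rw [Finset.mem_coe, Finset.mem_Ico, ← hb]
    exact ⟨Nat.mul_div_le _ _, Nat.lt_mul_div_succ _ (by positivity)⟩
  simpa using h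

open Classical in
theorem card_sameBlock_le {n : ℕ} (k : ℕ) (a : Fin n) :
    (Finset.univ.filter fun b : Fin n => SameBlock k a b).card ≤ 2 ^ (k + 1) := by
  refine le_trans (Finset.card_le_card fun b hb => ?_) (card_half_le (n := n) _ (half (k + 1) a))
  exact Finset.mem_filter.2 ⟨Finset.mem_univ b, (Finset.mem_filter.1 hb).2⟩

-- The hypothesis places `a` in a block that is not truncated by `n`, so both its halves are full.
open Classical in
theorem le_card_opposite {n k : ℕ} (a : Fin n) (ha : a.val < 2 ^ (k + 1) * (n / 2 ^ (k + 1))) :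
    2 ^ k ≤ (Finset.univ.filter fun b : Fin n => Opposite k a b).card := by
  set h := 2 ^ k with hh
  have hpos : 0 < h := by positivity
  have h2 : 2 ^ (k + 1) = 2 * h := by rw [pow_succ, mul_comm]
  obtain ⟨q, hq⟩ : ∃ q, q = a.val / (2 * h) := ⟨_, rfl⟩
  have hqn : 2 * h * (q + 1) ≤ n := by
    rw [h2] at ha
    have h1 : q < n / (2 * h) := by
      rw [hq]
      exact Nat.div_lt_of_lt_mul ha
    exact (Nat.mul_le_mul_left _ h1).trans (Nat.mul_div_le _ _)
  have hah : a.val / h / 2 = q := by rw [Nat.div_div_eq_div_mul, mul_comm, hq]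
  obtain ⟨e, he, hae⟩ : ∃ e < 2, a.val / h ≠ 2 * q + e := by
    by_cases h0 : a.val / h = 2 * q
    · exact ⟨1, by norm_num, by omega⟩
    · exact ⟨0, by norm_num, by omega⟩
  have hend : (2 * q + e + 1) * h ≤ 2 * h * (q + 1) := by
    have : (2 * q + e + 1) * h ≤ (2 * q + 2) * h := Nat.mul_le_mul_right _ (by omega)
    linarith
  have hsub : Finset.Ico ((2 * q + e) * h) ((2 * q + e) * h + h) ⊆
      (Finset.univ.filter fun b : Fin n => Opposite k a b).image Fin.val := by
    intro i hi
    rw [Finset.mem_Ico] at hi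
    have hin : i < n := by
      have : (2 * q + e + 1) * h = (2 * q + e) * h + h := by ring
      omega
    have hdiv : i / h = 2 * q + e := by
      rw [Nat.div_eq_iff hpos]
      have : (2 * q + e) * h + h - 1 < (2 * q + e) * h + h := by omega
      omega
    refine Finset.mem_image.2 ⟨⟨i, hin⟩, ?_, rfl⟩
    rw [Finset.mem_filter]
    refine ⟨Finset.mem_univ _, ?_, ?_⟩
    · simp only [SameBlock, half, h2]
      rw [← hq, mul_comm, ← Nat.div_div_eq_div_mul, hdiv]
      omega
    · simp only [half, ← hh, hdiv]
      exact hae.symm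
  have := (Finset.card_le_card hsub).trans Finset.card_image_le
  simpa using this

-- When at least one complete block fits, the complete blocks cover at least half of the keys.
open Classical in
theorem mul_le_two_mul_sum_card_opposite {n k : ℕ} (hk : 2 ^ (k + 1) ≤ n) :
    2 ^ k * n ≤ 2 * ∑ a : Fin n, (Finset.univ.filter fun b : Fin n => Opposite k a b).card := by
  set M := 2 ^ (k + 1) * (n / 2 ^ (k + 1)) with hM
  have hMn : M ≤ n := Nat.mul_div_le _ _
  have h1 : ∑ a : Fin n with a.val < M, 2 ^ k ≤
      ∑ a : Fin n, (Finset.univ.filter fun b : Fin n => Opposite k a b).card := by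
    refine (Finset.sum_le_sum fun a ha => le_card_opposite a (Finset.mem_filter.1 ha).2).trans ?_
    exact Finset.sum_le_sum_of_subset (Finset.filter_subset _ _)
  rw [Finset.sum_const, Fin.card_filter_val_lt, min_eq_right hMn, smul_eq_mul] at h1
  have h2 : n ≤ 2 * M := by
    have h3 : n < 2 ^ (k + 1) * (n / 2 ^ (k + 1) + 1) := Nat.lt_mul_div_succ _ (by positivity)
    have h4 : 1 ≤ n / 2 ^ (k + 1) := (Nat.one_le_div_iff (by positivity)).2 hk
    nlinarith
  calc 2 ^ k * n ≤ 2 ^ k * (2 * M) := Nat.mul_le_mul_left _ h2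
    _ = 2 * (M * 2 ^ k) := by ring
    _ ≤ _ := Nat.mul_le_mul_left _ h1

open Classical in
/-- The number of relabellings that map `z` to the half opposite to `x`. -/
noncomputable def oppositeCount {n : ℕ} (k : ℕ) (x z : Fin n) : ℕ :=
  ∑ π : Equiv.Perm (Fin n), if Opposite k (π x) (π z) then 1 else 0

-- By exchangeability in `z` and then in `x`, the images form a uniform ordered pair of distinct
-- keys; the count is the same for every `z ≠ x`.
open Classical in
theorem mul_oppositeCount {n k : ℕ} {x z : Fin n} (hxz : x ≠ z) :
    n * ((n - 1) * oppositeCount k x z) = n.factorial *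
      ∑ a : Fin n, (Finset.univ.filter fun b : Fin n => Opposite k a b).card := by
  have h1 : (n - 1) * oppositeCount k x z =
      ∑ π : Equiv.Perm (Fin n), (Finset.univ.filter fun b : Fin n => Opposite k (π x) b).card := by
    have hc : (Finset.univ.erase x : Finset (Fin n)).card = n - 1 := by simp
    rw [← hc, oppositeCount, card_mul_sum_perm (y := z)
      (g := fun π v => if Opposite k (π x) (π v) then 1 else 0)]
    · refine Finset.sum_congr rfl fun π _ => ?_
      rw [Finset.card_filter, ← Equiv.sum_comp π,
        ← Finset.add_sum_erase _ _ (Finset.mem_univ x)]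
      simp [Opposite]
    · intro v hv π
      simp only [Equiv.Perm.mul_apply, Equiv.swap_apply_left,
        Equiv.swap_apply_of_ne_of_ne hxz (Finset.ne_of_mem_erase hv).symm]
  rw [h1]
  have h2 := card_mul_sum_perm (Z := Finset.univ) (y := x)
    (g := fun π v => (Finset.univ.filter fun b : Fin n => Opposite k (π v) b).card)
    (fun v _ π => by simp)
  rw [Finset.card_univ, Fintype.card_fin] at h2
  rw [h2]
  simp_rw [fun π : Equiv.Perm (Fin n) => Equiv.sum_comp π
    (fun a => (Finset.univ.filter fun b : Fin n => Opposite k a b).card)]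
  simp [Fintype.card_perm]

-- Once `x` and `z` occupy two places of a block of size at most `B = 2 ^ (k + 1)`, a third key
-- falls into it with probability at most `(B - 2) / (n - 2)`, which is at most `B / n` because `B ≤
-- n`.
open Classical in
theorem mul_sum_opposite_sameBlock_le {n k : ℕ} (hk : 2 ^ (k + 1) ≤ n) {x z y : Fin n}
    (hxz : x ≠ z) (hxy : x ≠ y) (hzy : z ≠ y) :
    n * ∑ π : Equiv.Perm (Fin n),
      (if Opposite k (π x) (π z) ∧ SameBlock k (π x) (π y) then 1 else 0) ≤
      2 ^ (k + 1) * oppositeCount k x z := by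
  set N := ∑ π : Equiv.Perm (Fin n),
      (if Opposite k (π x) (π z) ∧ SameBlock k (π x) (π y) then 1 else 0) with hN
  set B := 2 ^ (k + 1) with hB
  have hn : 3 ≤ n := by
    have : ({x, z, y} : Finset (Fin n)).card = 3 := by
      rw [Finset.card_eq_three]
      exact ⟨x, z, y, hxz, hxy, hzy, rfl⟩
    simpa [this] using Finset.card_le_univ ({x, z, y} : Finset (Fin n))
  have h1 : (n - 2) * N ≤ (B - 2) * oppositeCount k x z := by
    have hc : ((Finset.univ.erase x).erase z : Finset (Fin n)).card = n - 2 := by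
      rw [Finset.card_erase_of_mem (by simp [hxz.symm]), Finset.card_erase_of_mem (by simp)]
      simp [Nat.sub_sub]
    rw [← hc, hN, card_mul_sum_perm (y := y) (g := fun π v =>
      if Opposite k (π x) (π z) ∧ SameBlock k (π x) (π v) then 1 else 0)]
    · rw [oppositeCount, Finset.mul_sum]
      refine Finset.sum_le_sum fun π _ => ?_
      by_cases ho : Opposite k (π x) (π z)
      swap
      · simp [ho]
      simp only [ho, true_and, if_true, mul_one]
      have h3 := card_sameBlock_le k (π x)
      rw [Finset.card_filter, ← Equiv.sum_comp π,
        ← Finset.add_sum_erase _ _ (Finset.mem_univ x),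
        ← Finset.add_sum_erase _ _ (show z ∈ Finset.univ.erase x by simp [hxz.symm])] at h3
      rw [if_pos (show SameBlock k (π x) (π x) from rfl), if_pos ho.1] at h3
      omega
    · intro v hv π
      simp only [Finset.mem_erase] at hv
      simp only [Equiv.Perm.mul_apply, Equiv.swap_apply_left,
        Equiv.swap_apply_of_ne_of_ne hxy hv.2.1.symm, Equiv.swap_apply_of_ne_of_ne hzy hv.1.symm]
  have h2 : (B - 2) * n ≤ B * (n - 2) := by
    obtain ⟨m, rfl⟩ := Nat.exists_eq_add_of_le (show 2 ≤ n by omega)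
    have hB2 : 2 ≤ B := by
      rw [hB, pow_succ]
      have := Nat.one_le_two_pow (n := k)
      omega
    obtain ⟨b, hb⟩ := Nat.exists_eq_add_of_le hB2
    rw [hb] at hk ⊢
    have e1 : 2 + b - 2 = b := by omega
    have e2 : 2 + m - 2 = m := by omega
    rw [e1, e2]
    nlinarith
  have h3 : (n - 2) * (n * N) ≤ (n - 2) * (B * oppositeCount k x z) := by
    calc (n - 2) * (n * N) = n * ((n - 2) * N) := by ring
      _ ≤ n * ((B - 2) * oppositeCount k x z) := Nat.mul_le_mul_left _ h1
      _ = ((B - 2) * n) * oppositeCount k x z := by ring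
      _ ≤ (B * (n - 2)) * oppositeCount k x z := Nat.mul_le_mul_right _ h2
      _ = _ := by ring
  exact Nat.le_of_mul_le_mul_left h3 (by omega)

-- Inclusion and exclusion for one fixed labelling: either a lone key of the block is opposite to
-- `x` and yields the alternation, or every opposite key is paid for by another key in the same
-- block.
open Classical in
theorem sum_opposite_le {n k t : ℕ} {x : Fin n} {H : List (Fin n)} :
    ∑ z ∈ ((recent x H).take t).toFinset, (if Opposite k x z then 1 else 0) ≤
      (if Alternates k x H then 1 else 0) +
      ∑ z ∈ ((recent x H).take t).toFinset, ∑ y ∈ ((recent x H).take t).toFinset.erase z,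
        if Opposite k x z ∧ SameBlock k x y then 1 else 0 := by
  set Z := ((recent x H).take t).toFinset with hZ
  by_cases h : ∃ z ∈ Z, Opposite k x z ∧ ∀ a ∈ Z, a ≠ z → ¬ SameBlock k x a
  · obtain ⟨z, hz, ho, ha⟩ := h
    have halt : Alternates k x H := alternates_of_opposite (List.mem_toFinset.1 hz) ho
      fun a h => ha a (List.mem_toFinset.2 h)
    rw [if_pos halt]
    refine le_trans ?_ (Nat.le_add_right _ _)
    rw [← Finset.card_filter, Finset.card_le_one]
    have key : ∀ a ∈ Z.filter (Opposite k x), a = z := by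
      intro a h
      by_contra hne
      exact ha a (Finset.mem_filter.1 h).1 hne (Finset.mem_filter.1 h).2.1
    exact fun a h b h' => (key a h).trans (key b h').symm
  · refine le_trans (Finset.sum_le_sum fun z hz => ?_) (Nat.le_add_left _ _)
    split_ifs with ho
    · push Not at h
      obtain ⟨a, haZ, hne, hs⟩ := h z hz ho
      refine le_trans ?_ (Finset.single_le_sum (fun _ _ => Nat.zero_le _)
        (Finset.mem_erase.2 ⟨hne, haZ⟩))
      simp [ho, hs]
    · exact Nat.zero_le _

open Classical in
theorem factorial_le_mul_sum_alternates {n k : ℕ} (hk : 2 ^ (k + 1) ≤ n) (x : Fin n)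
    (H : List (Fin n)) (ht : n / (4 * 2 ^ k) + 1 ≤ (recent x H).length) :
    (n.factorial : ℝ) / 16 ≤ ∑ π : Equiv.Perm (Fin n),
      if Alternates k (π x) (H.map π) then (1 : ℝ) else 0 := by
  -- With `t` about `n / (4 * 2 ^ k)`, the correction is at most half of the main term because `(t -
  -- 1) * 2 ^ (k + 1) / n ≤ 1/2`. The main term is at least `n! / 8`, since `t ≥ n / (4 * 2 ^ k)`
  -- and each summand is at least `n! * 2 ^ k / (2 * n)`.
  set t := n / (4 * 2 ^ k) + 1 with ht'
  set Z := ((recent x H).take t).toFinset with hZ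
  have hcard : Z.card = t := by
    rw [hZ, List.toFinset_card_of_nodup ((nodup_recent x H).sublist (List.take_sublist _ _)),
      List.length_take, min_eq_left ht]
  have hxZ : ∀ z ∈ Z, x ≠ z := fun z hz => (ne_of_mem_recent
    (List.mem_of_mem_take (List.mem_toFinset.1 hz))).symm
  set A := ∑ a : Fin n, (Finset.univ.filter fun b : Fin n => Opposite k a b).card with hA
  have hn2 : 2 ≤ n := by
    have := Nat.one_le_two_pow (n := k)
    rw [pow_succ] at hk
    omega
  have hnpos : (0 : ℝ) < n := by positivity
  have hn1 : (0 : ℝ) < (n : ℝ) - 1 := by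
    have : (2 : ℝ) ≤ n := by exact_mod_cast hn2
    linarith
  set N : ℝ := n.factorial * A / (n * (n - 1)) with hN
  have hN1 : ∀ z ∈ Z, (oppositeCount k x z : ℝ) = N := by
    intro z hz
    have h := mul_oppositeCount (k := k) (hxZ z hz)
    have h' : (n : ℝ) * (((n : ℝ) - 1) * oppositeCount k x z) = n.factorial * A := by
      rw [← Nat.cast_pred (by omega : 0 < n)]
      exact_mod_cast h
    rw [hN, eq_div_iff (by positivity), ← h']
    ring
  -- the expected number of alternations, by inclusion and exclusion
  have h1 : ∑ z ∈ Z, (oppositeCount k x z : ℝ) ≤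
      (∑ π : Equiv.Perm (Fin n), if Alternates k (π x) (H.map π) then (1 : ℝ) else 0) +
      ∑ z ∈ Z, ∑ y ∈ Z.erase z, ∑ π : Equiv.Perm (Fin n),
        (if Opposite k (π x) (π z) ∧ SameBlock k (π x) (π y) then (1 : ℝ) else 0) := by
    have h : ∀ π : Equiv.Perm (Fin n), ∑ z ∈ Z, (if Opposite k (π x) (π z) then 1 else 0) ≤
        (if Alternates k (π x) (H.map π) then 1 else 0) + ∑ z ∈ Z, ∑ y ∈ Z.erase z,
          if Opposite k (π x) (π z) ∧ SameBlock k (π x) (π y) then 1 else 0 := by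
      intro π
      have h := sum_opposite_le (k := k) (t := t) (x := π x) (H := H.map π)
      have hm : ((recent (π x) (H.map π)).take t).toFinset = Z.map π.toEmbedding := by
        ext a
        simp only [recent_map π.injective, ← List.map_take, hZ, List.mem_toFinset, List.mem_map,
          Finset.mem_map, Equiv.coe_toEmbedding]
      simp only [hm, Finset.sum_map, ← Finset.map_erase] at h
      exact h
    have h2 := Finset.sum_le_sum fun π (_ : π ∈ Finset.univ) => h π
    rw [Finset.sum_add_distrib, Finset.sum_comm, Finset.sum_comm (s := Finset.univ) (t := Z)] at h2
    simp_rw [Finset.sum_comm (s := Finset.univ) (t := Z.erase _)] at h2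
    unfold oppositeCount
    exact_mod_cast h2
  rw [Finset.sum_congr rfl hN1, Finset.sum_const, hcard, nsmul_eq_mul] at h1
  have h2 : ∑ z ∈ Z, ∑ y ∈ Z.erase z, ∑ π : Equiv.Perm (Fin n),
        (if Opposite k (π x) (π z) ∧ SameBlock k (π x) (π y) then (1 : ℝ) else 0) ≤
      t * (((t : ℝ) - 1) * (2 ^ (k + 1) / n * N)) := by
    have h3 : ∀ z ∈ Z, ∀ y ∈ Z.erase z, ∑ π : Equiv.Perm (Fin n),
        (if Opposite k (π x) (π z) ∧ SameBlock k (π x) (π y) then (1 : ℝ) else 0) ≤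
        2 ^ (k + 1) / n * N := by
      intro z hz y hy
      have h4 := mul_sum_opposite_sameBlock_le hk (hxZ z hz) (hxZ y (Finset.mem_of_mem_erase hy))
        (Finset.ne_of_mem_erase hy).symm
      rw [← hN1 z hz, div_mul_eq_mul_div, le_div_iff₀ hnpos, mul_comm]
      exact_mod_cast h4
    have h5 : ∀ z ∈ Z, ((Z.erase z).card : ℝ) = t - 1 := by
      intro z hz
      rw [Finset.card_erase_of_mem hz, hcard, ht']
      push_cast
      simp
    calc _ ≤ ∑ z ∈ Z, ((t : ℝ) - 1) * (2 ^ (k + 1) / n * N) := by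
          refine Finset.sum_le_sum fun z hz => ?_
          rw [← h5 z hz, ← nsmul_eq_mul]
          exact Finset.sum_le_card_nsmul _ _ _ (h3 z hz)
      _ = _ := by rw [Finset.sum_const, hcard, nsmul_eq_mul]
  have hN0 : (n.factorial : ℝ) * 2 ^ k / (2 * n) ≤ N := by
    have h3 : (2 : ℝ) ^ k * n ≤ 2 * A := by exact_mod_cast mul_le_two_mul_sum_card_opposite hk
    rw [hN, div_le_div_iff₀ (by positivity) (by positivity)]
    have h4 : (2 : ℝ) ^ k * (n - 1) ≤ 2 * A := by
      have : (0 : ℝ) < 2 ^ k := by positivity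
      nlinarith
    have h5 : (0 : ℝ) ≤ n.factorial * n := by positivity
    nlinarith [mul_le_mul_of_nonneg_left h4 h5]
  have ht1 : ((t : ℝ) - 1) * (4 * 2 ^ k) ≤ n := by
    have : (n / (4 * 2 ^ k)) * (4 * 2 ^ k) ≤ n := Nat.div_mul_le_self _ _
    rw [ht']
    push_cast
    rw [add_sub_cancel_right]
    exact_mod_cast this
  have ht2 : (n : ℝ) ≤ t * (4 * 2 ^ k) := by
    have h3 : n < 4 * 2 ^ k * (n / (4 * 2 ^ k) + 1) := Nat.lt_mul_div_succ _ (by positivity)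
    rw [← ht', mul_comm] at h3
    exact_mod_cast h3.le
  have hNpos : 0 ≤ N := le_trans (by positivity) hN0
  have h6 : ((t : ℝ) - 1) * (2 ^ (k + 1) / n) ≤ 1 / 2 := by
    rw [mul_div_assoc', div_le_div_iff₀ hnpos two_pos, pow_succ]
    linarith
  have h7 : (t : ℝ) * (((t : ℝ) - 1) * (2 ^ (k + 1) / n * N)) ≤ t * (1 / 2 * N) := by
    rw [← mul_assoc ((t : ℝ) - 1)]
    exact mul_le_mul_of_nonneg_left (mul_le_mul_of_nonneg_right h6 hNpos) (Nat.cast_nonneg t)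
  have h8 : (n.factorial : ℝ) / 16 ≤ t * (1 / 2 * N) := by
    have h9 : (n.factorial : ℝ) / 8 ≤ t * (n.factorial * 2 ^ k / (2 * n)) := by
      rw [mul_div_assoc', div_le_div_iff₀ (by norm_num) (by positivity)]
      have := mul_le_mul_of_nonneg_left ht2 (Nat.cast_nonneg (α := ℝ) n.factorial)
      linarith
    have h10 := mul_le_mul_of_nonneg_left hN0 (Nat.cast_nonneg (α := ℝ) t)
    linarith
  linarith

-- A working set of size `w` has enough recent keys for the estimate at the `Nat.log 2 w` coarsest
-- levels, so the sum over levels is reflected to count from the top.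
open Classical in
theorem factorial_mul_log_le_sum_alternations {n : ℕ} (x : Fin n) (H : List (Fin n)) :
    (n.factorial : ℝ) / 16 * Nat.log 2 ((recent x H).length + 1) ≤
      ∑ π : Equiv.Perm (Fin n), (alternations (Nat.log 2 n) (π x) (H.map π) : ℝ) := by
  set w := (recent x H).length + 1 with hw
  set K := Nat.log 2 n with hK
  have hnpos : n ≠ 0 := fun h => (h ▸ x).elim0
  have hwn : w ≤ n := by
    have h1 : x ∉ (recent x H).toFinset := fun h => ne_of_mem_recent (List.mem_toFinset.1 h) rfl
    have h2 := Finset.card_le_univ (insert x (recent x H).toFinset)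
    rwa [Finset.card_insert_of_notMem h1, List.toFinset_card_of_nodup (nodup_recent _ _),
      Fintype.card_fin] at h2
  have hlog : Nat.log 2 w ≤ K := Nat.log_mono_right hwn
  have hKn : 2 ^ K ≤ n := Nat.pow_log_le_self 2 hnpos
  have hnK : n < 2 ^ (K + 1) := Nat.lt_pow_succ_log_self one_lt_two n
  have h : ∀ π : Equiv.Perm (Fin n), (alternations K (π x) (H.map π) : ℝ) =
      ∑ k ∈ Finset.range K, if Alternates k (π x) (H.map π) then (1 : ℝ) else 0 := by
    intro π
    rw [alternations, Finset.sum_boole]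
  simp_rw [h]
  rw [Finset.sum_comm, ← Finset.sum_range_reflect]
  calc _ = ∑ i ∈ Finset.range (Nat.log 2 w), (n.factorial : ℝ) / 16 := by
        rw [Finset.sum_const, Finset.card_range, nsmul_eq_mul, mul_comm]
    _ ≤ ∑ i ∈ Finset.range (Nat.log 2 w), ∑ π : Equiv.Perm (Fin n),
        if Alternates (K - 1 - i) (π x) (H.map π) then (1 : ℝ) else 0 := by
      refine Finset.sum_le_sum fun i hi => ?_
      have hi := Finset.mem_range.1 hi
      have hiw : 2 ^ (i + 1) ≤ w := Nat.pow_le_of_le_log (by omega) hi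
      obtain ⟨j, hj⟩ : ∃ j, K = j + i + 1 := ⟨K - 1 - i, by omega⟩
      have hj' : K - 1 - i = j := by omega
      rw [hj']
      refine factorial_le_mul_sum_alternates ?_ x H ?_
      · exact (Nat.pow_le_pow_right two_pos (by omega)).trans hKn
      -- Hence the required prefix has length at most `2 ^ i`, which is at most `w - 1` since `2 ^
      -- (i + 1) ≤ w`.
      · have h1 : n / (4 * 2 ^ j) < 2 ^ i := by
          rw [Nat.div_lt_iff_lt_mul (by positivity)]
          have : 2 ^ (K + 1) = 2 ^ i * (4 * 2 ^ j) := by rw [hj]; ring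
          omega
        have h2 := Nat.one_le_two_pow (n := i)
        rw [pow_succ] at hiw
        omega
    _ ≤ _ := by
      refine Finset.sum_le_sum_of_subset_of_nonneg ?_ fun i _ _ =>
        Finset.sum_nonneg fun π _ => by split_ifs <;> simp
      exact Finset.range_subset_range.2 hlog

theorem logb_le_two_mul_log (w : ℕ) (hw : w ≠ 0) : Real.logb 2 w ≤ 2 * Nat.log 2 w := by
  rcases Nat.lt_or_ge w 2 with h | h
  · obtain rfl : w = 1 := by omega
    simp
  have h1 : (w : ℝ) ≤ 2 ^ (Nat.log 2 w + 1) := by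
    exact_mod_cast (Nat.lt_pow_succ_log_self one_lt_two w).le
  have h2 := Real.logb_le_logb_of_le one_lt_two (by positivity) h1
  rw [Real.logb_pow, Real.logb_self_eq_one one_lt_two, mul_one] at h2
  have h3 : (1 : ℝ) ≤ Nat.log 2 w := by exact_mod_cast Nat.log_pos one_lt_two h
  push_cast at h2
  linarith

/-- The constant is `64 = 16 * 2 * 2`: the alternation probability, the interleave bound, and the
rounding of the logarithm. The tree `T` only ensures that the optimum is attained. -/
theorem factorial_mul_WS_le_sum_optCost {n : ℕ} (κ : ℕ) {T : BinaryTree (Fin n)}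
    (hT : IsBSTOn n T) (S : List (Fin n)) :
    (n.factorial : ℝ) * WS S ≤ 64 * ∑ π : Equiv.Perm (Fin n), (optCost κ (S.map π) : ℝ) := by
  have h1 : ∀ π : Equiv.Perm (Fin n),
      histSum (fun x H => (alternations (Nat.log 2 n) (π x) (H.map π) : ℝ)) [] S ≤
        2 * (optCost κ (S.map π) : ℝ) := by
    intro π
    obtain ⟨T', hT', hs⟩ := exists_serves_optCost κ hT (S.map π)
    have h := hs.interleave_le_two_mul κ (Nat.log 2 n) hT'.ordered
    have hm := histSum_map (alternations (n := n) (Nat.log 2 n)) π [] S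
    rw [List.map_nil] at hm
    rw [hm] at h
    rw [← cast_histSum]
    exact_mod_cast h
  have h2 := Finset.sum_le_sum fun π (_ : π ∈ Finset.univ) => h1 π
  rw [sum_histSum, ← Finset.mul_sum] at h2
  have h3 : histSum (fun x H => (n.factorial : ℝ) / 32 * logWorkingSet x H) [] S ≤
      histSum (fun x H => ∑ π : Equiv.Perm (Fin n),
        (alternations (Nat.log 2 n) (π x) (H.map π) : ℝ)) [] S := by
    refine histSum_mono (fun x H => le_trans ?_ (factorial_mul_log_le_sum_alternations x H)) _ _
    have h4 := logb_le_two_mul_log ((recent x H).length + 1) (Nat.succ_ne_zero _)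
    push_cast at h4
    have h5 := mul_le_mul_of_nonneg_left h4 (Nat.cast_nonneg (α := ℝ) n.factorial)
    rw [logWorkingSet]
    linarith
  rw [histSum_mul, ← WS_eq_histSum] at h3
  linarith

/-! ### Key-independent costs -/

theorem relabelledMean_le {n : ℕ} {f : List (Fin n) → ℕ} {S : List (Fin n)} {c : ℝ}
    (h : ∑ π : Equiv.Perm (Fin n), (f (S.map π) : ℝ) ≤ n.factorial * c) :
    relabelledMean f S ≤ c := by
  rw [relabelledMean, div_le_iff₀ (by positivity), mul_comm]
  exact h

theorem le_relabelledMean {n : ℕ} {f : List (Fin n) → ℕ} {S : List (Fin n)} {c : ℝ}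
    (h : n.factorial * c ≤ ∑ π : Equiv.Perm (Fin n), (f (S.map π) : ℝ)) :
    c ≤ relabelledMean f S := by
  rw [relabelledMean, le_div_iff₀ (by positivity), mul_comm]
  exact h

theorem kiMTR_le {n : ℕ} (κ : ℕ) {T : BinaryTree (Fin n)} (hT : IsBSTOn n T)
    (S : List (Fin n)) :
    kiMTR κ T S ≤ κ * S.length + 4 * WS S + ∑ i, (depth i T : ℝ) :=
  relabelledMean_le (sum_mtrCost_le κ hT S)

theorem kiOPT_le_two_mul_kiMTR {n : ℕ} (κ : ℕ) {T : BinaryTree (Fin n)} (hT : IsBSTOn n T)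
    (S : List (Fin n)) : kiOPT κ S ≤ 2 * kiMTR κ T S := by
  rw [kiOPT, kiMTR, relabelledMean, relabelledMean, mul_div_assoc', Finset.mul_sum]
  gcongr with π
  exact_mod_cast optCost_le_two_mul_mtrCost κ hT (S.map π)

theorem mul_length_le_kiOPT {n : ℕ} (κ : ℕ) {T : BinaryTree (Fin n)} (hT : IsBSTOn n T)
    (S : List (Fin n)) : κ * S.length ≤ kiOPT κ S := by
  refine le_relabelledMean ?_
  have h : ∑ _π : Equiv.Perm (Fin n), ((κ : ℝ) * S.length) = n.factorial * (κ * S.length) := by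
    simp [Fintype.card_perm]
  rw [← h]
  refine Finset.sum_le_sum fun π _ => ?_
  obtain ⟨T', -, hs⟩ := exists_serves_optCost κ hT (S.map π)
  have := hs.mul_length_le
  rw [List.length_map] at this
  exact_mod_cast this

theorem WS_le_mul_kiOPT {n : ℕ} (κ : ℕ) {T : BinaryTree (Fin n)} (hT : IsBSTOn n T)
    (S : List (Fin n)) : WS S ≤ 64 * kiOPT κ S := by
  have h : WS S / 64 ≤ kiOPT κ S := by
    refine le_relabelledMean ?_
    have := factorial_mul_WS_le_sum_optCost κ hT S
    linarith
  linarith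

theorem WS_nonneg {n : ℕ} (S : List (Fin n)) : 0 ≤ WS S :=
  Finset.sum_nonneg fun j _ => by
    rcases Nat.eq_zero_or_pos (workingSet S j).card with h | h
    · simp [h]
    · exact Real.logb_nonneg one_lt_two (by exact_mod_cast h)

end KIBST

theorem mainTheorem4 :
    -- upper bound for an arbitrary initial tree, with an absolute constant
    (∃ C : ℝ, 0 < C ∧ ∀ (κ n : ℕ) (T : BinaryTree (Fin n)) (S : List (Fin n)),
      KIBST.IsBSTOn n T →
        KIBST.kiMTR κ T S ≤
          C * (κ * S.length + KIBST.WS S + ∑ i : Fin n, (KIBST.depth i T : ℝ))) ∧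
    -- initial trees of logarithmic depth; the constant depends only on the depth factor `a`
    (∀ a : ℝ, 0 < a → ∃ C : ℝ, 0 < C ∧
      ∀ (κ n : ℕ) (T : BinaryTree (Fin n)) (S : List (Fin n)),
        KIBST.IsBSTOn n T →
        (∀ i : Fin n, (KIBST.depth i T : ℝ) ≤ a * Real.logb 2 n) →
        -- every access sequence: equivalence up to an additive multiple of `n log n`
        (KIBST.kiOPT κ S ≤ C * KIBST.kiMTR κ T S ∧
          KIBST.kiMTR κ T S ≤ C * (KIBST.kiOPT κ S + n * Real.logb 2 n) ∧
          KIBST.kiMTR κ T S ≤ C * (κ * S.length + KIBST.WS S + n * Real.logb 2 n) ∧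
          KIBST.AgreeUpTo C (KIBST.kiOPT κ S + n * Real.logb 2 n)
            (κ * S.length + KIBST.WS S + n * Real.logb 2 n)) ∧
        -- sequences of length at least `n log n`, and sequences that access every key
        ((n * Real.logb 2 n ≤ κ * S.length ∨ ∀ i : Fin n, i ∈ S) →
          KIBST.AgreeUpTo C (KIBST.kiMTR κ T S) (KIBST.kiOPT κ S + n * Real.logb 2 n) ∧
          KIBST.AgreeUpTo C (KIBST.kiMTR κ T S)
            (κ * S.length + KIBST.WS S + n * Real.logb 2 n) ∧
          KIBST.AgreeUpTo C (KIBST.kiMTR κ T S) (KIBST.kiOPT κ S) ∧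
          KIBST.AgreeUpTo C (KIBST.kiMTR κ T S) (κ * S.length + KIBST.WS S))) := by
  refine ⟨⟨4, by norm_num, fun κ n T S hT => ?_⟩, fun a ha => ⟨(a + 4) * 600, by positivity,
    fun κ n T S hT hd => ?_⟩⟩
  · have h := KIBST.kiMTR_le κ hT S
    have h1 : (0 : ℝ) ≤ ∑ i, (KIBST.depth i T : ℝ) := by positivity
    have h2 : (0 : ℝ) ≤ (κ : ℝ) * S.length := by positivity
    linarith
  obtain ⟨L, hL⟩ : ∃ L, L = n * Real.logb 2 n := ⟨_, rfl⟩
  have hL0 : 0 ≤ L := by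
    rcases Nat.eq_zero_or_pos n with rfl | h
    · simp [hL]
    · rw [hL]
      exact mul_nonneg (Nat.cast_nonneg n) (Real.logb_nonneg one_lt_two (by exact_mod_cast h))
  have hD : ∑ i, (KIBST.depth i T : ℝ) ≤ a * L := by
    refine (Finset.sum_le_sum fun i _ => hd i).trans (le_of_eq ?_)
    rw [Finset.sum_const, Finset.card_univ, Fintype.card_fin, nsmul_eq_mul, hL]
    ring
  have h1 := KIBST.kiMTR_le κ hT S
  have h2 := KIBST.kiOPT_le_two_mul_kiMTR κ hT S
  have h3 := KIBST.mul_length_le_kiOPT κ hT S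
  have h4 := KIBST.WS_le_mul_kiOPT κ hT S
  have h5 := KIBST.WS_nonneg S
  have h6 : (0 : ℝ) ≤ (κ : ℝ) * S.length := by positivity
  -- Both alternatives enter only through this inequality, which absorbs `n log n`.
  have h7 : L ≤ κ * S.length ∨ (∀ i : Fin n, i ∈ S) →
      L ≤ κ * S.length + 2 * KIBST.WS S := by
    rintro (h | h)
    · linarith
    · have := KIBST.mul_logb_le_two_mul_WS h
      linarith
  simp only [← hL, KIBST.AgreeUpTo]
  generalize KIBST.kiMTR κ T S = R at *
  generalize KIBST.kiOPT κ S = O at *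
  generalize KIBST.WS S = W at *
  generalize (κ : ℝ) * S.length = M at *
  have hO : 0 ≤ O := by linarith
  have hR : 0 ≤ R := by linarith
  -- The products with `a` are supplied as atoms, which makes all remaining goals linear.
  have hC : ∀ y : ℝ, 0 ≤ y → 0 ≤ a * y := fun y hy => mul_nonneg ha.le hy
  have haL := hC L hL0
  have haO := hC O hO
  have haR := hC R hR
  have haW := hC W h5
  have haM := hC M h6
  refine ⟨⟨by linarith, by linarith, by linarith, by linarith, by linarith⟩, fun h => ?_⟩
  have h10 := h7 h
  -- `M ≤ O` and `W ≤ 64 * O` give `M + 2 * W ≤ 129 * O`.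
  have h8 : L ≤ 129 * O := by linarith
  have h9 := mul_le_mul_of_nonneg_left h8 ha.le
  have h11 := mul_le_mul_of_nonneg_left h10 ha.le
  exact ⟨⟨by linarith, by linarith⟩, ⟨by linarith, by linarith⟩, ⟨by linarith, by linarith⟩,
    by linarith, by linarith⟩
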